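/- Let $N\ge 1$, let $\Omega\subset\mathbb R^N$ be a bounded Lipschitz domain and $\mathbb T^N=(\mathbb R/2\pi\mathbb Z)^N$. Let $m:\mathbb T^N\to(0,\infty)$ be of class $C^q$ for an integer $q>2N$, let $H\in C^2(\Omega)$ be real valued, and put $\omega=\nabla H$, $a=m^{-1/N}$, $\rho=m^{1/N}$. Let $\Phi_t$ be the flow on $\Omega\times\mathbb T^N$ of the weighted Hamiltonian system $$\dot I=0,\qquad \dot\theta=a(\theta)\,\omega(I).$$ Assume: (D1) there is a real $\tau$ with $2(N-1)<2\tau\le q-N-1$ such that for almost every $I\in\Omega$ there is $\alpha=\alpha(I)>0$ with $|n\cdot\omega(I)|\ge\alpha|n|^{-\tau}$ for all $n\in\mathbb Z^N\setminus\{0\}$; (D2) there is $\lambda>0$ such that the smallest singular value of $D\omega(I)$ is at least $\lambda$ for every $I\in\Omega$; moreover $D\omega$ is differentiable on $\Omega$, and $D\omega$ and $D^2\omega$ are bounded on $\Omega$. Let $f_0\ge 0$ be an initial density in $W^{1,1}_I(\Omega\times\mathbb T^N)$, that is, $f_0$ and its weak gradient $\partial_I f_0$ are integrable on $\Omega\times\mathbb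 T^N$, and suppose that $W(I):=\int_{\mathbb T^N}f_0(I,\theta)\rho(\theta)\,d\theta$ belongs to $W^{1,1}(\Omega)$. Put $d\mu_*=\rho(\theta)\,d\theta\,dI$ and define the statistical ensemble and the weighted equilibrium measure by $$P_t=(\Phi_t)_\#(f_0\,d\mu_*),\qquad dP^{(m)}_{\mathrm{eq}}=W(I)\,dI\otimes\frac{\rho(\theta)}{\int_{\mathbb T^N}\rho(\vartheta)\,d\vartheta}\,d\theta .$$ Let $G:\overline\Omega\times\mathbb T^N\to\mathbb R$ be of class $C^r$ up to the boundary, with $r>N+1$ an integer. Then $G$ is integrable with respect to $P_{\mathrm{eq}}^{(m)}$ and every $P_t$, and $$\lim_{t\to\infty}\int G\,dP_t=\int G\,dP^{(m)}_{\mathrm{eq}} .$$ -/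

import Mathlib

open MeasureTheory Filter Topology

instance factTwoPiPos : Fact (0 < 2 * Real.pi) := ⟨Real.two_pi_pos⟩

/-- Euclidean space `ℝ^N`. -/
abbrev Euc (N : ℕ) : Type := EuclideanSpace ℝ (Fin N)

/-- The torus `𝕋^N = (ℝ / 2πℤ)^N`. Its `volume` is Lebesgue measure, of total mass `(2π)^N`. -/
abbrev Torus (N : ℕ) : Type := Fin N → AddCircle (2 * Real.pi)

/-- The covering map `ℝ^N → 𝕋^N`. -/
noncomputable def torusProj {N : ℕ} (x : Euc N) : Torus N := fun j => (x j : AddCircle (2 * Real.pi))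

/-- A bounded Lipschitz domain: bounded, open, connected and nonempty, and near each boundary
point it is the region on one side of the graph of a Lipschitz function, in Cartesian coordinates
whose last axis points in the direction `e`. (Only the values of `γ` on the hyperplane orthogonal
to `e` matter.) -/
structure IsBoundedLipschitzDomain {N : ℕ} (Ω : Set (Euc N)) : Prop where
  isOpen : IsOpen Ω
  isConnected : IsConnected Ω
  isBounded : Bornology.IsBounded Ω
  lipschitz_boundary : ∀ p ∈ frontier Ω, ∃ e : Euc N, ‖e‖ = 1 ∧
    ∃ (γ : Euc N → ℝ) (K : NNReal), LipschitzWith K γ ∧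
      ∃ δ > 0, ∀ y ∈ Metric.ball p δ, y ∈ Ω ↔ γ (y - inner ℝ e y • e) < inner ℝ e y

/-- `m ∈ C^q(𝕋^N)`. -/
def TorusContDiff {N : ℕ} (q : ℕ) (m : Torus N → ℝ) : Prop :=
  ContDiff ℝ q fun x : Euc N => m (torusProj x)

/-- The lift of a function on `ℝ^N × 𝕋^N` to `ℝ^N × ℝ^N`. -/
noncomputable def phaseLift {N : ℕ} (G : Euc N × Torus N → ℝ) : Euc N × Euc N → ℝ :=
  fun z => G (z.1, torusProj z.2)

/-- `G ∈ C^r(Ω̄ × 𝕋^N)`: `G` is continuous on `Ω̄ × 𝕋^N`, of class `C^r` on `Ω × 𝕋^N`, and all its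
derivatives of order at most `r` extend continuously to `Ω̄ × 𝕋^N`. -/
def MemCrClosure {N : ℕ} (r : ℕ) (Ω : Set (Euc N)) (G : Euc N × Torus N → ℝ) : Prop :=
  ContinuousOn G (closure Ω ×ˢ Set.univ) ∧
  ContDiffOn ℝ r (phaseLift G) (Ω ×ˢ Set.univ) ∧
  ∀ k ≤ r, ∃ F : Euc N × Euc N → (Euc N × Euc N) [×k]→L[ℝ] ℝ,
    ContinuousOn F (closure Ω ×ˢ Set.univ) ∧
    Set.EqOn F (iteratedFDeriv ℝ k (phaseLift G)) (Ω ×ˢ Set.univ)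

/-- `W ∈ W^{1,1}(Ω)`: `W` is integrable on `Ω` and has an integrable weak gradient there. -/
def MemW11 {N : ℕ} (Ω : Set (Euc N)) (W : Euc N → ℝ) : Prop :=
  IntegrableOn W Ω ∧
  ∃ g : Euc N → Euc N, IntegrableOn g Ω ∧
    ∀ φ : Euc N → ℝ, ContDiff ℝ (⊤ : ℕ∞) φ → HasCompactSupport φ → tsupport φ ⊆ Ω →
      ∀ v : Euc N, ∫ I in Ω, W I * fderiv ℝ φ I v = - ∫ I in Ω, inner ℝ (g I) v * φ I

/-- `f ∈ W_I^{1,1}(Ω × 𝕋^N)`: `f` is integrable on `Ω × 𝕋^N` and has there an integrable weak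
gradient with respect to the action variable `I`. -/
def MemW11Action {N : ℕ} (Ω : Set (Euc N)) (f : Euc N × Torus N → ℝ) : Prop :=
  IntegrableOn f (Ω ×ˢ Set.univ) ∧
  ∃ g : Euc N × Torus N → Euc N, IntegrableOn g (Ω ×ˢ Set.univ) ∧
    ∀ φ : Euc N × Torus N → ℝ, ContDiff ℝ (⊤ : ℕ∞) (phaseLift φ) → HasCompactSupport φ →
      tsupport φ ⊆ Ω ×ˢ Set.univ →
      ∀ v : Euc N,
        ∫ z in Ω ×ˢ Set.univ, f z * fderiv ℝ (fun I => φ (I, z.2)) z.1 v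
          = - ∫ z in Ω ×ˢ Set.univ, inner ℝ (g z) v * φ z

/-- `a(θ) = m(θ)^{-1/N}`. -/
noncomputable def speed {N : ℕ} (m : Torus N → ℝ) (θ : Torus N) : ℝ := m θ ^ (-(1 / (N : ℝ)))

/-- `ρ(θ) = m(θ)^{1/N}`. -/
noncomputable def rho {N : ℕ} (m : Torus N → ℝ) (θ : Torus N) : ℝ := m θ ^ (1 / (N : ℝ))

/-- The integer vector `n ∈ ℤ^N` as an element of `ℝ^N`. -/
noncomputable def intVec {N : ℕ} (n : Fin N → ℤ) : Euc N := WithLp.toLp 2 fun j => (n j : ℝ)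

/-- `γ : ℝ → 𝕋^N` is the solution of `θ' = a(θ) w` with `θ(0) = θ₀`: it has a lift to `ℝ^N` that
satisfies the equation. -/
def IsAngularMotion {N : ℕ} (m : Torus N → ℝ) (w : Euc N) (θ₀ : Torus N) (γ : ℝ → Torus N) :
    Prop :=
  γ 0 = θ₀ ∧ ∃ x : ℝ → Euc N, (∀ t, γ t = torusProj (x t)) ∧
    ∀ t, HasDerivAt x (speed m (γ t) • w) t

theorem torusProj_surjective {N : ℕ} : Function.Surjective (torusProj (N := N)) := by
  intro θ
  choose x hx using fun j => QuotientAddGroup.mk_surjective (θ j)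
  exact ⟨WithLp.toLp 2 x, funext hx⟩

theorem continuous_torusProj {N : ℕ} : Continuous (torusProj (N := N)) := by
  refine continuous_pi fun j => ?_
  exact (AddCircle.continuous_mk' _).comp (by fun_prop)

theorem torusProj_add {N : ℕ} (x y : Euc N) :
    torusProj (x + y) = torusProj x + torusProj y := by
  ext j; simp [torusProj]

/-- For a continuous positive weight the angular equation of motion has, from each initial angle,
exactly one solution, and it is defined for all times. -/
theorem existsUnique_angularMotion {N : ℕ} {m : Torus N → ℝ} (hc : Continuous m)
    (hpos : ∀ θ, 0 < m θ) (w : Euc N) (θ₀ : Torus N) : ∃! γ, IsAngularMotion m w θ₀ γ := by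
  obtain ⟨x₀, rfl⟩ := torusProj_surjective θ₀
  have hrc : Continuous (rho m) := hc.rpow_const fun θ => Or.inl (hpos θ).ne'
  have hrpos : ∀ θ, 0 < rho m θ := fun θ => Real.rpow_pos_of_pos (hpos θ) _
  have hsp : ∀ θ, speed m θ = (rho m θ)⁻¹ := fun θ => Real.rpow_neg (hpos θ).le _
  obtain ⟨θm, -, hθm⟩ := (isCompact_univ (X := Torus N)).exists_isMinOn ⟨0, trivial⟩ hrc.continuousOn
  set c := rho m θm with hcdef
  have hcpos : 0 < c := hrpos _
  have hcle : ∀ θ, c ≤ rho m θ := fun θ => hθm (Set.mem_univ θ)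
  set g : ℝ → ℝ := fun u => rho m (torusProj (x₀ + u • w)) with hg
  have hgc : Continuous g := hrc.comp (continuous_torusProj.comp (by fun_prop))
  set S : ℝ → ℝ := fun u => ∫ s in (0 : ℝ)..u, g s with hS
  have hSd : ∀ u, HasDerivAt S (g u) u := fun u =>
    intervalIntegral.integral_hasDerivAt_right (hgc.intervalIntegrable _ _)
      (hgc.stronglyMeasurableAtFilter _ _) hgc.continuousAt
  have hSmono : StrictMono S := strictMono_of_deriv_pos fun u => by
    rw [(hSd u).deriv]; exact hrpos _
  have hSc : Continuous S := continuous_iff_continuousAt.2 fun u => (hSd u).continuousAt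
  have hS0 : S 0 = 0 := by simp [hS]
  have hmono2 : Monotone fun u => S u - c * u := by
    refine monotone_of_deriv_nonneg (fun u => ((hSd u).sub
      ((hasDerivAt_id u).const_mul c)).differentiableAt) fun u => ?_
    have h := ((hSd u).sub ((hasDerivAt_id u).const_mul c)).deriv
    have h2 : deriv (fun u => S u - c * u) u = g u - c * 1 := h
    rw [h2]
    have := hcle (torusProj (x₀ + u • w))
    simp only [hg]; linarith
  have hSsurj : Function.Surjective S := by
    refine hSc.surjective ?_ ?_
    · refine tendsto_atTop_mono' atTop ?_ (tendsto_id.const_mul_atTop hcpos)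
      filter_upwards [eventually_ge_atTop 0] with u hu
      have := hmono2 hu
      simp only [hS0, mul_zero, sub_zero] at this
      simp only [id]; linarith
    · refine tendsto_atBot_mono' atBot ?_ (tendsto_id.const_mul_atBot hcpos)
      filter_upwards [eventually_le_atBot 0] with u hu
      have := hmono2 hu
      simp only [hS0, mul_zero, sub_zero] at this
      simp only [id]; linarith
  set e := hSmono.orderIsoOfSurjective S hSsurj with he
  have heS : ∀ u, e u = S u := fun u => rfl
  have hsd : ∀ t, HasDerivAt (fun t => e.symm t) (g (e.symm t))⁻¹ t := fun t =>
    HasDerivAt.of_local_left_inverse e.symm.continuous.continuousAt (hSd _)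
      (hrpos _).ne' (Eventually.of_forall fun y => by rw [← heS]; simp)
  have hes0 : e.symm 0 = 0 := by
    rw [OrderIso.symm_apply_eq]; exact hS0.symm
  refine ⟨fun t => torusProj (x₀ + e.symm t • w), ⟨by simp [hes0],
    fun t => x₀ + e.symm t • w, fun t => rfl, fun t => ?_⟩, ?_⟩
  · simp only [hsp]
    exact ((hsd t).smul_const w).const_add x₀
  · rintro γ ⟨hγ0, x, hγ, hx⟩
    have hxc : Continuous x := continuous_iff_continuousAt.2 fun t => (hx t).continuousAt
    have hac : Continuous fun t => speed m (γ t) := by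
      simp only [hsp, hγ]
      exact (hrc.comp (continuous_torusProj.comp hxc)).inv₀ fun t => (hrpos _).ne'
    set σ : ℝ → ℝ := fun t => ∫ s in (0 : ℝ)..t, speed m (γ s) with hσ
    have hσd : ∀ t, HasDerivAt σ (speed m (γ t)) t := fun t =>
      intervalIntegral.integral_hasDerivAt_right (hac.intervalIntegrable _ _)
        (hac.stronglyMeasurableAtFilter _ _) hac.continuousAt
    have hσ0 : σ 0 = 0 := by simp [hσ]
    have hxσ : ∀ t, x t = x 0 + σ t • w := by
      have hd : ∀ t, HasDerivAt (fun t => x t - σ t • w) 0 t := fun t => by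
        have h := (hx t).sub ((hσd t).smul_const w)
        rw [sub_self] at h
        exact h
      intro t
      have := is_const_of_deriv_eq_zero (fun t => (hd t).differentiableAt)
        (fun t => (hd t).deriv) t 0
      simp only [hσ0, zero_smul, sub_zero] at this
      rw [← this]; abel
    have hγσ : ∀ t, γ t = torusProj (x₀ + σ t • w) := fun t => by
      rw [hγ, hxσ, torusProj_add, torusProj_add, ← hγ, hγ0]
    have hSσ : ∀ t, S (σ t) = t := by
      have hd : ∀ t, HasDerivAt (fun t => S (σ t) - t) 0 t := fun t => by
        have h := ((hSd (σ t)).comp t (hσd t)).sub (hasDerivAt_id t)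
        have h1 : g (σ t) * speed m (γ t) - 1 = 0 := by
          rw [hsp, hγσ, sub_eq_zero]
          exact mul_inv_cancel₀ (hrpos _).ne'
        rw [h1] at h
        exact h
      intro t
      have := is_const_of_deriv_eq_zero (fun t => (hd t).differentiableAt)
        (fun t => (hd t).deriv) t 0
      simp only [hσ0, hS0, sub_zero] at this
      linarith
    funext t
    have : e.symm t = σ t := by
      rw [OrderIso.symm_apply_eq, heS, hSσ]
    rw [hγσ, this]

/-- The angle at time `t` of the solution of `θ' = a(θ) w` that starts at `θ₀`. -/
noncomputable def angularFlow {N : ℕ} (m : Torus N → ℝ) (w : Euc N) (t : ℝ) (θ₀ : Torus N) :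
    Torus N :=
  Classical.epsilon (IsAngularMotion m w θ₀) t

theorem isAngularMotion_angularFlow {N : ℕ} {m : Torus N → ℝ} (hc : Continuous m)
    (hpos : ∀ θ, 0 < m θ) (w : Euc N) (θ₀ : Torus N) :
    IsAngularMotion m w θ₀ fun t => angularFlow m w t θ₀ :=
  Classical.epsilon_spec (existsUnique_angularMotion hc hpos w θ₀).exists

/-- The flow `Φ_t` of the weighted Hamiltonian system `I' = 0`, `θ' = m(θ)^{-1/N} ω(I)`,
`ω = ∇H`. -/
noncomputable def phaseFlow {N : ℕ} (m : Torus N → ℝ) (H : Euc N → ℝ) (t : ℝ)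
    (z : Euc N × Torus N) : Euc N × Torus N :=
  (z.1, angularFlow m (gradient H z.1) t z.2)

/-- The weighted invariant measure `dμ_* = ρ(θ) dθ dI` on `Ω × 𝕋^N`. -/
noncomputable def muStar {N : ℕ} (Ω : Set (Euc N)) (m : Torus N → ℝ) :
    Measure (Euc N × Torus N) :=
  (volume.restrict (Ω ×ˢ Set.univ)).withDensity fun z => ENNReal.ofReal (rho m z.2)

/-- The statistical ensemble `P_t = (Φ_t)_# (f₀ dμ_*)`. -/
noncomputable def ensemble {N : ℕ} (Ω : Set (Euc N)) (m : Torus N → ℝ) (H : Euc N → ℝ)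
    (f₀ : Euc N × Torus N → ℝ) (t : ℝ) : Measure (Euc N × Torus N) :=
  ((muStar Ω m).withDensity fun z => ENNReal.ofReal (f₀ z)).map (phaseFlow m H t)

/-- `W(I) = ∫ f₀(I,θ) ρ(θ) dθ`. -/
noncomputable def actionMarginal {N : ℕ} (m : Torus N → ℝ) (f₀ : Euc N × Torus N → ℝ)
    (I : Euc N) : ℝ :=
  ∫ θ : Torus N, f₀ (I, θ) * rho m θ

/-- The weighted equilibrium measure `W(I) dI ⊗ (ρ(θ) / Z_ρ) dθ` on `Ω × 𝕋^N`. -/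
noncomputable def equilibrium {N : ℕ} (Ω : Set (Euc N)) (m : Torus N → ℝ)
    (f₀ : Euc N × Torus N → ℝ) : Measure (Euc N × Torus N) :=
  ((volume.restrict Ω).withDensity fun I => ENNReal.ofReal (actionMarginal m f₀ I)).prod
    ((volume : Measure (Torus N)).withDensity fun θ =>
      ENNReal.ofReal (rho m θ / ∫ ϑ : Torus N, rho m ϑ))

/-! For a fixed frequency w the angle moves along the line θ + ℝw with speed factor 1/ρ. It is the
linear flow run on another clock: the integral of ρ along the line from θ to θ + uw is the elapsed
time. Substituting this clock turns the time mean of g into the quotient of the linear means of gρ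
and of ρ. Weyl equidistribution then gives the ρ-weighted mean for every rationally independent w
(`tendsto_mean_angularFlow`).

Homogeneity upgrades time means to a limit in t. The angle at time t with frequency w is the angle
at time 1 with frequency tw (`angularFlow_smul`). For a fixed initial angle, the observable at time
t is therefore F(tw) with F bounded, and F has the same mean M along almost every ray. This forces
F(t ·) → M weakly against L¹ (`tendsto_integral_mul_dilation`): dilations act continuously on L¹, so
the pairing hardly changes when t is replaced by tc with c in [1, 1 + d], and averaging over c
replaces F by its mean over a long stretch of the ray.

Nondegeneracy makes ω a local diffeomorphism, so the image of Lebesgue measure on Ω is absolutely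
continuous and the L¹ statement in w becomes one in I (`absolutelyContinuous_map_gradient`). The
dependence of density and observable on I is handled by approximating maps into C(𝕋^N) by simple
functions, and the initial angle is integrated out at the end by Fubini and dominated convergence.
-/

/-! ### Characters and their density in C(𝕋^N) -/

/-- The character `θ ↦ exp (i n·θ)` of the torus. -/
noncomputable def torusChar {N : ℕ} (n : Fin N → ℤ) : C(Torus N, ℂ) where
  toFun θ := ∏ i, fourier (n i) (θ i)
  continuous_toFun := by fun_prop

theorem torusChar_apply {N : ℕ} (n : Fin N → ℤ) (θ : Torus N) :
    torusChar n θ = ∏ i, fourier (n i) (θ i) := rfl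

theorem torusChar_zero {N : ℕ} : torusChar (0 : Fin N → ℤ) = 1 := by
  ext θ; simp [torusChar_apply]

theorem torusChar_add {N : ℕ} (n k : Fin N → ℤ) :
    torusChar (n + k) = torusChar n * torusChar k := by
  ext θ; simp [torusChar_apply, Finset.prod_mul_distrib]

theorem torusChar_add_apply {N : ℕ} (n : Fin N → ℤ) (θ η : Torus N) :
    torusChar n (θ + η) = torusChar n θ * torusChar n η := by
  simp [torusChar_apply, Finset.prod_mul_distrib, fourier_apply, smul_add, AddCircle.toCircle_add]

theorem torusChar_torusProj {N : ℕ} (n : Fin N → ℤ) (x : Euc N) :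
    torusChar n (torusProj x) = Complex.exp (inner ℝ (intVec n) x * Complex.I) := by
  simp only [torusChar_apply, torusProj, fourier_coe_apply, ← Complex.exp_sum]
  congr 1
  simp only [PiLp.inner_apply, intVec, Complex.ofReal_sum, Finset.sum_mul]
  refine Finset.sum_congr rfl fun i _ => ?_
  have h : (Real.pi : ℂ) ≠ 0 := by exact_mod_cast Real.pi_ne_zero
  simp
  field_simp

/-- The star subalgebra generated by the characters of the torus. -/
noncomputable def torusCharSubalgebra (N : ℕ) : StarSubalgebra ℂ C(Torus N, ℂ) where
  toSubalgebra := Algebra.adjoin ℂ (Set.range torusChar)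
  star_mem' := by
    change Algebra.adjoin ℂ (Set.range torusChar) ≤ star (Algebra.adjoin ℂ (Set.range torusChar))
    refine Algebra.adjoin_le ?_
    rintro _ ⟨n, rfl⟩
    refine Algebra.subset_adjoin ⟨-n, ?_⟩
    ext θ
    simp [torusChar_apply]

/-- A product of characters is a character, so generating an algebra adds nothing beyond linear
combinations. -/
theorem torusCharSubalgebra_coe (N : ℕ) :
    (torusCharSubalgebra N).toSubalgebra.toSubmodule =
      Submodule.span ℂ (Set.range (torusChar (N := N))) := by
  apply Algebra.adjoin_eq_span_of_subset
  refine .trans (fun x ↦ Submonoid.closure_induction (fun _ ↦ id) ⟨0, torusChar_zero⟩ ?_)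
    Submodule.subset_span
  rintro _ _ _ _ ⟨m, rfl⟩ ⟨n, rfl⟩
  exact ⟨m + n, torusChar_add m n⟩

theorem torusCharSubalgebra_separatesPoints (N : ℕ) :
    (torusCharSubalgebra N).SeparatesPoints := by
  classical
  intro x y hxy
  rw [Ne, funext_iff, not_forall] at hxy
  obtain ⟨i, hi⟩ := hxy
  refine ⟨_, ⟨torusChar (Pi.single i 1), Algebra.subset_adjoin ⟨Pi.single i 1, rfl⟩, rfl⟩, ?_⟩
  have key : ∀ z : Torus N, torusChar (Pi.single i 1) z = fourier 1 (z i) := fun z => by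
    rw [torusChar_apply, Finset.prod_eq_single i]
    · simp
    · intro j _ hj; simp [hj]
    · simp
  dsimp only
  rw [key, key, fourier_one, fourier_one]
  exact fun h => hi (AddCircle.injective_toCircle Real.two_pi_pos.ne' (Circle.ext h))

/-- Stone–Weierstrass: the characters span a star subalgebra that separates points. -/
theorem span_torusChar_topologicalClosure_eq_top (N : ℕ) :
    (Submodule.span ℂ (Set.range (torusChar (N := N)))).topologicalClosure = ⊤ := by
  rw [← torusCharSubalgebra_coe]
  exact congr_arg (Subalgebra.toSubmodule <| StarSubalgebra.toSubalgebra ·)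
    (ContinuousMap.starSubalgebra_topologicalClosure_eq_top_of_separatesPoints _
      (torusCharSubalgebra_separatesPoints N))

/-- Translating by η preserves the integral but multiplies it by a factor different from 1. -/
theorem integral_torusChar_eq_zero {N : ℕ} {n : Fin N → ℤ} {η : Torus N}
    (h : torusChar n η ≠ 1) : ∫ θ, torusChar n θ = 0 := by
  have h1 : ∫ θ, torusChar n (θ + η) = ∫ θ, torusChar n θ :=
    integral_add_right_eq_self (μ := (volume : Measure (Torus N))) (torusChar n) η
  simp only [torusChar_add_apply, integral_mul_const] at h1
  by_contra h0
  exact h (mul_left_cancel₀ h0 (by rw [h1, mul_one]))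

/-! ### Weyl equidistribution for linear flows -/

/-- The oscillating integral stays bounded by 2/|b|, so dividing by T kills it. -/
theorem tendsto_inv_mul_integral_exp {b : ℝ} (hb : b ≠ 0) :
    Tendsto (fun T : ℝ => T⁻¹ • ∫ s in (0 : ℝ)..T, Complex.exp (s * b * Complex.I)) atTop
      (𝓝 0) := by
  have hc : (b : ℂ) * Complex.I ≠ 0 := by simp [hb]
  have key : ∀ T : ℝ, ‖∫ s in (0 : ℝ)..T, Complex.exp (s * b * Complex.I)‖ ≤ 2 / |b| := by
    intro T
    have h1 : (fun s : ℝ => Complex.exp (s * b * Complex.I))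
        = fun s : ℝ => Complex.exp ((b * Complex.I) * s) := by
      funext s; ring_nf
    rw [h1, integral_exp_mul_complex hc, norm_div]
    have h2 : ‖(b : ℂ) * Complex.I‖ = |b| := by simp
    rw [h2]
    gcongr
    refine (norm_sub_le _ _).trans ?_
    have h3 : (b : ℂ) * Complex.I * T = ((b * T : ℝ) : ℂ) * Complex.I := by push_cast; ring
    have h4 : (b : ℂ) * Complex.I * (0 : ℝ) = ((0 : ℝ) : ℂ) * Complex.I := by simp
    rw [h3, h4, Complex.norm_exp_ofReal_mul_I, Complex.norm_exp_ofReal_mul_I]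
    norm_num
  refine squeeze_zero_norm (a := fun T => |T⁻¹| * (2 / |b|)) (fun T => ?_) ?_
  · rw [norm_smul, Real.norm_eq_abs]
    gcongr
    exact key T
  · have h := (tendsto_inv_atTop_zero (𝕜 := ℝ)).abs.mul_const (2 / |b|)
    simpa using h

theorem norm_inv_smul_integral_le {E : Type*} [NormedAddCommGroup E] [NormedSpace ℝ E]
    {f : ℝ → E} {C : ℝ} (hC : 0 ≤ C) (hf : ∀ s, ‖f s‖ ≤ C) (T : ℝ) :
    ‖T⁻¹ • ∫ s in (0 : ℝ)..T, f s‖ ≤ C := by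
  rw [norm_smul, norm_inv, Real.norm_eq_abs]
  have h := intervalIntegral.norm_integral_le_of_norm_le_const (a := 0) (b := T) (f := f)
    (C := C) (fun s _ => hf s)
  rw [sub_zero] at h
  rcases eq_or_ne T 0 with rfl | hT
  · simpa using hC
  · rw [inv_mul_le_iff₀ (abs_pos.2 hT), mul_comm]
    exact h

theorem continuous_comp_linear_flow {N : ℕ} {E : Type*} [TopologicalSpace E] (f : C(Torus N, E))
    (θ : Torus N) (w : Euc N) : Continuous fun s : ℝ => f (θ + torusProj (s • w)) :=
  f.continuous.comp (continuous_const.add (continuous_torusProj.comp (by fun_prop)))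

/-- Weyl equidistribution: the mean along a linear flow with rationally independent frequencies
is the space average. -/
theorem tendsto_mean_linear_flow_complex {N : ℕ} {w : Euc N}
    (hw : ∀ n : Fin N → ℤ, n ≠ 0 → inner ℝ (intVec n) w ≠ 0) (θ : Torus N) (f : C(Torus N, ℂ)) :
    Tendsto (fun T : ℝ => T⁻¹ • ∫ s in (0 : ℝ)..T, f (θ + torusProj (s • w))) atTop
      (𝓝 (⨍ η, f η)) := by
  have hint : ∀ g : C(Torus N, ℂ), Integrable g := fun g =>
    g.continuous.integrable_of_hasCompactSupport (HasCompactSupport.of_compactSpace g)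
  -- The observables with the claimed limit form a subspace, so it suffices to check characters and
  -- then pass to uniform limits.
  let S : Submodule ℂ C(Torus N, ℂ) :=
    { carrier := {f | Tendsto (fun T : ℝ => T⁻¹ • ∫ s in (0 : ℝ)..T, f (θ + torusProj (s • w)))
        atTop (𝓝 (⨍ η, f η))}
      zero_mem' := by simp [average_eq]
      add_mem' := by
        intro f g hf hg
        simp only [Set.mem_ofPred_eq, ContinuousMap.add_apply] at *
        rw [average_eq, integral_add (hint f) (hint g), smul_add, ← average_eq, ← average_eq]
        refine (hf.add hg).congr fun T => ?_
        rw [intervalIntegral.integral_add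
          ((continuous_comp_linear_flow f θ w).intervalIntegrable _ _)
          ((continuous_comp_linear_flow g θ w).intervalIntegrable _ _), smul_add]
      smul_mem' := by
        intro c f hf
        simp only [Set.mem_ofPred_eq, ContinuousMap.smul_apply] at *
        rw [average_eq, integral_smul, smul_comm, ← average_eq]
        refine (hf.const_smul c).congr fun T => ?_
        rw [intervalIntegral.integral_smul, smul_comm] }
  have hchar : Submodule.span ℂ (Set.range torusChar) ≤ S := by
    rw [Submodule.span_le]
    rintro _ ⟨n, rfl⟩
    change Tendsto _ _ _
    by_cases hn : n = 0
    · subst hn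
      rw [torusChar_zero]
      have h1 : ⨍ η : Torus N, (1 : C(Torus N, ℂ)) η = 1 := by
        simp
      rw [h1]
      refine tendsto_const_nhds.congr' ?_
      filter_upwards [eventually_gt_atTop 0] with T hT
      simp [hT.ne']
    · have hb := hw n hn
      have hv : ∫ θ, torusChar n θ = 0 := by
        -- At this translation n·η = π, so the character takes the value -1.
        refine integral_torusChar_eq_zero
          (η := torusProj ((Real.pi / inner ℝ (intVec n) w) • w)) ?_
        rw [torusChar_torusProj, inner_smul_right, div_mul_cancel₀ _ hb, Complex.exp_pi_mul_I]
        norm_num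
      rw [average_eq, hv, smul_zero]
      have h := (tendsto_inv_mul_integral_exp hb).const_mul (torusChar n θ)
      rw [mul_zero] at h
      refine h.congr fun T => ?_
      rw [mul_smul_comm, ← intervalIntegral.integral_const_mul]
      congr 2
      ext s
      rw [torusChar_add_apply, torusChar_torusProj, inner_smul_right]
      push_cast
      rfl
  have hcl : f ∈ (Submodule.span ℂ (Set.range (torusChar (N := N)))).topologicalClosure := by
    rw [span_torusChar_topologicalClosure_eq_top]; trivial
  rw [Metric.tendsto_atTop]
  intro ε hε
  -- Line means and the space mean are both contractions for the sup norm, uniformly in T, so each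
  -- costs at most ε/3.
  obtain ⟨g, hgS, hg⟩ := Metric.mem_closure_iff.1 hcl (ε / 3) (by positivity)
  have hgS : Tendsto _ _ _ := hchar hgS
  obtain ⟨T₀, hT₀⟩ := Metric.tendsto_atTop.1 hgS (ε / 3) (by positivity)
  refine ⟨T₀, fun T hT => ?_⟩
  have hb : ∀ η, ‖(f - g) η‖ ≤ ε / 3 := fun η => by
    refine ((f - g).norm_coe_le_norm η).trans ?_
    rw [← dist_eq_norm]; exact hg.le
  have h1 : dist (T⁻¹ • ∫ s in (0 : ℝ)..T, f (θ + torusProj (s • w)))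
      (T⁻¹ • ∫ s in (0 : ℝ)..T, g (θ + torusProj (s • w))) ≤ ε / 3 := by
    rw [dist_eq_norm, ← smul_sub, ← intervalIntegral.integral_sub
          ((continuous_comp_linear_flow f θ w).intervalIntegrable _ _)
          ((continuous_comp_linear_flow g θ w).intervalIntegrable _ _)]
    exact norm_inv_smul_integral_le (by positivity) (fun s => hb _) T
  have h2 : dist (⨍ η, g η) (⨍ η, f η) ≤ ε / 3 := by
    rw [dist_comm, dist_eq_norm, average_eq, average_eq, ← smul_sub,
      ← integral_sub (hint f) (hint g), norm_smul]
    have h3 := norm_integral_le_of_norm_le_const (μ := (volume : Measure (Torus N)))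
      (f := fun a => f a - g a) (C := ε / 3) (Eventually.of_forall hb)
    have h4 : 0 < (volume : Measure (Torus N)).real Set.univ := by
      rw [measureReal_def, ENNReal.toReal_pos_iff]
      exact ⟨(isOpen_univ.measure_pos _ ⟨0, trivial⟩), measure_lt_top _ _⟩
    rw [norm_inv, Real.norm_eq_abs, abs_of_pos h4, inv_mul_le_iff₀ h4]
    exact h3.trans_eq (mul_comm _ _)
  have h3 := dist_triangle4 (T⁻¹ • ∫ s in (0 : ℝ)..T, f (θ + torusProj (s • w)))
    (T⁻¹ • ∫ s in (0 : ℝ)..T, g (θ + torusProj (s • w))) (⨍ η, g η) (⨍ η, f η)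
  linarith [hT₀ T hT]

theorem tendsto_mean_linear_flow {N : ℕ} {w : Euc N}
    (hw : ∀ n : Fin N → ℤ, n ≠ 0 → inner ℝ (intVec n) w ≠ 0) (θ : Torus N) (f : C(Torus N, ℝ)) :
    Tendsto (fun T : ℝ => T⁻¹ * ∫ s in (0 : ℝ)..T, f (θ + torusProj (s • w))) atTop
      (𝓝 (⨍ η, f η)) := by
  have h := tendsto_mean_linear_flow_complex hw θ
    ⟨fun η => (f η : ℂ), Complex.continuous_ofReal.comp f.continuous⟩
  simp only [ContinuousMap.coe_mk, average_eq, intervalIntegral.integral_ofReal] at h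
  have h2 := (Complex.continuous_re.tendsto _).comp h
  rw [integral_complex_ofReal] at h2
  simpa [average_eq, Function.comp_def] using h2

/-! ### Resonant frequencies and the frequency map -/

/-- Almost every frequency vector is rationally independent. -/
theorem ae_rationally_independent (N : ℕ) :
    ∀ᵐ w : Euc N, ∀ n : Fin N → ℤ, n ≠ 0 → inner ℝ (intVec n) w ≠ 0 := by
  rw [ae_all_iff]
  intro n
  by_cases hn : n = 0
  · simp [hn]
  have hv : intVec n ≠ 0 := by
    intro h
    refine hn (funext fun i => ?_)
    have := congrArg (fun v : Euc N => v i) h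
    simpa [intVec] using this
  -- Each nonzero n excludes only a hyperplane, and there are countably many n.
  have h0 : volume ((LinearMap.ker (innerSL ℝ (intVec n)).toLinearMap : Submodule ℝ (Euc N)) :
      Set (Euc N)) = 0 := by
    refine Measure.addHaar_submodule _ _ fun htop => ?_
    have : intVec n ∈ LinearMap.ker (innerSL ℝ (intVec n)).toLinearMap := by rw [htop]; trivial
    simp at this
    exact hv this
  filter_upwards [measure_eq_zero_iff_ae_notMem.1 h0] with w hw _ h
  exact hw (by simpa using h)

/-- Singular values are indexed from 0 in decreasing order, so the one at N - 1 is the smallest and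
its positivity makes all of them positive. -/
theorem injective_of_le_singularValues {N : ℕ} (hN : 0 < N) {L : Euc N →ₗ[ℝ] Euc N} {lam : ℝ}
    (hlam : 0 < lam) (h : lam ≤ L.singularValues (N - 1)) : Function.Injective L := by
  rw [LinearMap.injective_iff_forall_lt_finrank_singularValues_pos]
  intro i hi
  rw [finrank_euclideanSpace_fin] at hi
  exact (hlam.trans_le h).trans_le (L.singularValues_antitone (by omega))

/-- A map that is strictly differentiable on an open set, with injective derivative, pulls null
sets back to null sets. -/
theorem absolutelyContinuous_map_of_injective_fderiv {E : Type*} [NormedAddCommGroup E]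
    [InnerProductSpace ℝ E] [FiniteDimensional ℝ E] [MeasurableSpace E] [BorelSpace E]
    {Ω : Set E} (hΩ : IsOpen Ω) {f : E → E} {f' : E → E →L[ℝ] E} (hfm : Measurable f)
    (hf : ∀ x ∈ Ω, HasStrictFDerivAt f (f' x) x) (hinj : ∀ x ∈ Ω, Function.Injective (f' x)) :
    (volume.restrict Ω).map f ≪ (volume : Measure E) := by
  refine Measure.AbsolutelyContinuous.mk fun s hs h0 => ?_
  rw [Measure.map_apply hfm hs, Measure.restrict_apply (hfm hs)]
  refine measure_null_of_locally_null _ fun x hx => ?_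
  have hdet : ∀ y ∈ Ω, (f' y).det ≠ 0 := fun y hy => by
    have := LinearMap.isUnit_iff_ker_eq_bot (f' y).toLinearMap |>.2 (LinearMap.ker_eq_bot.2 (hinj y hy))
    exact (LinearMap.isUnit_iff_isUnit_det _).1 this |>.ne_zero
  let e : E ≃L[ℝ] E := (LinearEquiv.ofInjectiveEndo (f' x).toLinearMap (hinj x hx.2)).toContinuousLinearEquiv
  have he : (e : E →L[ℝ] E) = f' x := by ext y; rfl
  have hs' : HasStrictFDerivAt f (e : E →L[ℝ] E) x := he ▸ hf x hx.2
  let U := (hs'.toOpenPartialHomeomorph f).source ∩ Ω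
  have hUo : IsOpen U := (hs'.toOpenPartialHomeomorph f).open_source.inter hΩ
  have hxU : x ∈ U := ⟨hs'.mem_toOpenPartialHomeomorph_source, hx.2⟩
  have hUinj : Set.InjOn f U := (hs'.toOpenPartialHomeomorph f).injOn.mono Set.inter_subset_left
  refine ⟨(f ⁻¹' s ∩ Ω) ∩ U, inter_mem_nhdsWithin _ (hUo.mem_nhds hxU), ?_⟩
  set A := (f ⁻¹' s ∩ Ω) ∩ U with hA
  have hAm : MeasurableSet A := ((hfm hs).inter hΩ.measurableSet).inter hUo.measurableSet
  -- On A the map is injective, so the integral of |det f'| over A is at most the volume of f(A),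
  -- which lies in the null set s. As the determinant never vanishes on A, this forces A to be null.
  have key := lintegral_abs_det_fderiv_le_addHaar_image volume hAm
    (fun y hy => (hf y hy.1.2).hasFDerivAt.hasFDerivWithinAt) (hUinj.mono Set.inter_subset_right)
  have h1 : volume (f '' A) = 0 :=
    measure_mono_null (Set.image_subset_iff.2 fun y hy => hy.1.1) h0
  rw [h1, nonpos_iff_eq_zero] at key
  by_contra hpos
  have := (setLIntegral_pos_iff (μ := volume) (s := A)
    (f := fun y => ENNReal.ofReal |(fderiv ℝ f y).det|) ?_).2 ?_
  · refine this.ne' ?_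
    rw [← key]
    refine setLIntegral_congr_fun hAm fun y hy => ?_
    simp only [(hf y hy.1.2).hasFDerivAt.fderiv]
  · refine ENNReal.measurable_ofReal.comp ?_
    exact (continuous_abs.comp ContinuousLinearMap.continuous_det).measurable.comp
      (measurable_fderiv ℝ f)
  · rw [Set.inter_eq_self_of_subset_right]
    · exact pos_iff_ne_zero.2 hpos
    · intro y hy
      simp [Function.mem_support, (hf y hy.1.2).hasFDerivAt.fderiv, hdet y hy.1.2]

theorem contDiffOn_gradient {N : ℕ} {Ω : Set (Euc N)} (hΩ : IsOpen Ω) {H : Euc N → ℝ}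
    (hH : ContDiffOn ℝ 2 H Ω) : ContDiffOn ℝ 1 (gradient H) Ω := by
  have h1 : ContDiffOn ℝ 1 (fderiv ℝ H) Ω := hH.fderiv_of_isOpen hΩ (by norm_num)
  exact ((InnerProductSpace.toDual ℝ (Euc N)).symm.toContinuousLinearEquiv.contDiff).comp_contDiffOn h1

theorem measurable_gradient {N : ℕ} (H : Euc N → ℝ) : Measurable (gradient H) :=
  (InnerProductSpace.toDual ℝ (Euc N)).symm.continuous.measurable.comp (measurable_fderiv ℝ H)

/-- A nondegenerate frequency map pushes Lebesgue measure to an absolutely continuous measure. -/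
theorem absolutelyContinuous_map_gradient {N : ℕ} (hN : 0 < N) {Ω : Set (Euc N)} (hΩ : IsOpen Ω)
    {H : Euc N → ℝ} (hH : ContDiffOn ℝ 2 H Ω) {lam : ℝ} (hlam : 0 < lam)
    (hD2 : ∀ I ∈ Ω, lam ≤ (fderiv ℝ (gradient H) I).toLinearMap.singularValues (N - 1)) :
    (volume.restrict Ω).map (gradient H) ≪ (volume : Measure (Euc N)) :=
  absolutelyContinuous_map_of_injective_fderiv hΩ (measurable_gradient H)
    (fun _ hx => ((contDiffOn_gradient hΩ hH).contDiffAt (hΩ.mem_nhds hx)).hasStrictFDerivAt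
      one_ne_zero)
    (fun x hx => injective_of_le_singularValues hN hlam (hD2 x hx))

/-! ### The weighted flow as a time change of the linear flow -/

/-- The covering map is a quotient map, so continuity of the lift descends to the torus. -/
theorem continuous_of_torusContDiff {N q : ℕ} {m : Torus N → ℝ} (hm : TorusContDiff q m) :
    Continuous m := by
  have hq : IsOpenQuotientMap (torusProj (N := N)) := by
    have h1 : IsOpenQuotientMap (Pi.map fun (_ : Fin N) (x : ℝ) => (x : AddCircle (2 * Real.pi))) :=
      IsOpenQuotientMap.piMap fun _ => QuotientAddGroup.isOpenQuotientMap_mk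
    exact h1.comp (PiLp.homeomorph 2 fun _ : Fin N => ℝ).isOpenQuotientMap
  exact hq.isQuotientMap.continuous_iff.2 (ContDiff.continuous hm)

theorem continuous_rho {N : ℕ} {m : Torus N → ℝ} (hc : Continuous m) (hpos : ∀ θ, 0 < m θ) :
    Continuous (rho m) := hc.rpow_const fun θ => Or.inl (hpos θ).ne'

theorem rho_pos {N : ℕ} {m : Torus N → ℝ} (hpos : ∀ θ, 0 < m θ) (θ : Torus N) : 0 < rho m θ :=
  Real.rpow_pos_of_pos (hpos θ) _

theorem speed_eq_inv_rho {N : ℕ} {m : Torus N → ℝ} (hpos : ∀ θ, 0 < m θ) (θ : Torus N) :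
    speed m θ = (rho m θ)⁻¹ := Real.rpow_neg (hpos θ).le _

theorem exists_pos_le_rho {N : ℕ} {m : Torus N → ℝ} (hc : Continuous m) (hpos : ∀ θ, 0 < m θ) :
    ∃ c > 0, ∀ θ, c ≤ rho m θ := by
  obtain ⟨θm, -, hθm⟩ := (isCompact_univ (X := Torus N)).exists_isMinOn ⟨0, trivial⟩
    (continuous_rho hc hpos).continuousOn
  exact ⟨rho m θm, rho_pos hpos θm, fun θ => hθm (Set.mem_univ θ)⟩

/-- The time the weighted flow needs to move from `θ` to `θ + u w`. -/
noncomputable def travelTime {N : ℕ} (m : Torus N → ℝ) (w : Euc N) (θ : Torus N) (u : ℝ) : ℝ :=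
  ∫ s in (0 : ℝ)..u, rho m (θ + torusProj (s • w))

/-- The inverse of `travelTime`. -/
noncomputable def linearTime {N : ℕ} (m : Torus N → ℝ) (w : Euc N) (θ : Torus N) (t : ℝ) : ℝ :=
  Function.invFun (travelTime m w θ) t

section

variable {N : ℕ} {m : Torus N → ℝ} (hc : Continuous m) (hpos : ∀ θ, 0 < m θ)

include hc hpos

theorem continuous_travelTime :
    Continuous fun p : (Euc N × Torus N) × ℝ => travelTime m p.1.1 p.1.2 p.2 := by
  refine intervalIntegral.continuous_parametric_intervalIntegral_of_continuous
    (f := fun (p : (Euc N × Torus N) × ℝ) s => rho m (p.1.2 + torusProj (s • p.1.1))) ?_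
    continuous_snd
  refine (continuous_rho hc hpos).comp (Continuous.add (by fun_prop) ?_)
  exact continuous_torusProj.comp (by fun_prop)

theorem hasDerivAt_travelTime (w : Euc N) (θ : Torus N) (u : ℝ) :
    HasDerivAt (travelTime m w θ) (rho m (θ + torusProj (u • w))) u := by
  have hgc := continuous_comp_linear_flow ⟨rho m, continuous_rho hc hpos⟩ θ w
  exact intervalIntegral.integral_hasDerivAt_right (hgc.intervalIntegrable _ _)
      (hgc.stronglyMeasurableAtFilter _ _) hgc.continuousAt

theorem strictMono_travelTime (w : Euc N) (θ : Torus N) : StrictMono (travelTime m w θ) :=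
  strictMono_of_deriv_pos fun u => by
    rw [(hasDerivAt_travelTime hc hpos w θ u).deriv]; exact rho_pos hpos _

theorem surjective_travelTime (w : Euc N) (θ : Torus N) :
    Function.Surjective (travelTime m w θ) := by
  obtain ⟨c, hcpos, hcle⟩ := exists_pos_le_rho hc hpos
  have hd := hasDerivAt_travelTime hc hpos w θ
  have h0 : travelTime m w θ 0 = 0 := by simp [travelTime]
  -- Because ρ ≥ c > 0, the travel time grows at least linearly in both directions.
  have hmono : Monotone fun u => travelTime m w θ u - c * u := by
    have hd2 : ∀ u, HasDerivAt (fun u => travelTime m w θ u - c * u)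
        (rho m (θ + torusProj (u • w)) - c * 1) u := fun u =>
      (hd u).sub ((hasDerivAt_id u).const_mul c)
    refine monotone_of_deriv_nonneg (fun u => (hd2 u).differentiableAt) fun u => ?_
    rw [(hd2 u).deriv, mul_one]
    exact sub_nonneg.2 (hcle _)
  refine (continuous_iff_continuousAt.2 fun u => (hd u).continuousAt).surjective ?_ ?_
  · refine tendsto_atTop_mono' atTop ?_ (tendsto_id.const_mul_atTop hcpos)
    filter_upwards [eventually_ge_atTop 0] with u hu
    have := hmono hu
    simp only [h0, mul_zero, sub_zero] at this
    simp only [id]; linarith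
  · refine tendsto_atBot_mono' atBot ?_ (tendsto_id.const_mul_atBot hcpos)
    filter_upwards [eventually_le_atBot 0] with u hu
    have := hmono hu
    simp only [h0, mul_zero, sub_zero] at this
    simp only [id]; linarith

theorem travelTime_linearTime (w : Euc N) (θ : Torus N) (t : ℝ) :
    travelTime m w θ (linearTime m w θ t) = t :=
  Function.invFun_eq (surjective_travelTime hc hpos w θ t)

theorem linearTime_lt_iff {w : Euc N} {θ : Torus N} {t b : ℝ} :
    linearTime m w θ t < b ↔ t < travelTime m w θ b := by
  rw [← (strictMono_travelTime hc hpos w θ).lt_iff_lt, travelTime_linearTime hc hpos]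

theorem lt_linearTime_iff {w : Euc N} {θ : Torus N} {t b : ℝ} :
    b < linearTime m w θ t ↔ travelTime m w θ b < t := by
  rw [← (strictMono_travelTime hc hpos w θ).lt_iff_lt, travelTime_linearTime hc hpos]

/-- Joint continuity in frequency, angle and time: comparing the inverse with b amounts to comparing
t with the travel time to b, which is a continuous function of the parameters. -/
theorem continuous_linearTime :
    Continuous fun p : (Euc N × Torus N) × ℝ => linearTime m p.1.1 p.1.2 p.2 := by
  have h : ∀ b : ℝ, Continuous fun p : (Euc N × Torus N) × ℝ => travelTime m p.1.1 p.1.2 b :=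
    fun b => (continuous_travelTime hc hpos).comp (by fun_prop :
      Continuous fun p : (Euc N × Torus N) × ℝ => (p.1, b))
  rw [continuous_iff_lower_upperSemicontinuous, lowerSemicontinuous_iff_isOpen_preimage,
    upperSemicontinuous_iff_isOpen_preimage]
  refine ⟨fun b => ?_, fun b => ?_⟩
  · simp only [Set.preimage, Set.mem_Ioi, lt_linearTime_iff hc hpos]
    exact isOpen_lt (h b) continuous_snd
  · simp only [Set.preimage, Set.mem_Iio, linearTime_lt_iff hc hpos]
    exact isOpen_lt continuous_snd (h b)

theorem linearTime_zero (w : Euc N) (θ : Torus N) : linearTime m w θ 0 = 0 :=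
  (strictMono_travelTime hc hpos w θ).injective (by
    rw [travelTime_linearTime hc hpos]; simp [travelTime])

theorem hasDerivAt_linearTime (w : Euc N) (θ : Torus N) (t : ℝ) :
    HasDerivAt (linearTime m w θ) (rho m (θ + torusProj (linearTime m w θ t • w)))⁻¹ t :=
  HasDerivAt.of_local_left_inverse
    ((continuous_linearTime hc hpos).comp (by fun_prop :
      Continuous fun t : ℝ => ((w, θ), t))).continuousAt
    (hasDerivAt_travelTime hc hpos w θ _) (rho_pos hpos _).ne'
    (Eventually.of_forall (travelTime_linearTime hc hpos w θ))

theorem tendsto_linearTime (w : Euc N) (θ : Torus N) :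
    Tendsto (linearTime m w θ) atTop atTop := by
  refine tendsto_atTop.2 fun b => ?_
  filter_upwards [eventually_gt_atTop (travelTime m w θ b)] with t ht
  exact ((lt_linearTime_iff hc hpos).2 ht).le

/-- The time-changed line solves the equation of motion, and solutions are unique. -/
theorem angularFlow_eq (w : Euc N) (t : ℝ) (θ : Torus N) :
    angularFlow m w t θ = θ + torusProj (linearTime m w θ t • w) := by
  have h : IsAngularMotion m w θ fun t => θ + torusProj (linearTime m w θ t • w) := by
    obtain ⟨x₀, rfl⟩ := torusProj_surjective θ
    refine ⟨by ext; simp [linearTime_zero hc hpos, torusProj],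
      fun t => x₀ + linearTime m w (torusProj x₀) t • w, fun t => (torusProj_add _ _).symm,
      fun t => ?_⟩
    rw [speed_eq_inv_rho hpos]
    exact ((hasDerivAt_linearTime hc hpos w _ t).smul_const w).const_add x₀
  exact congrFun ((existsUnique_angularMotion hc hpos w θ).unique
    (isAngularMotion_angularFlow hc hpos w θ) h) t

theorem continuous_angularFlow :
    Continuous fun p : (Euc N × Torus N) × ℝ => angularFlow m p.1.1 p.2 p.1.2 := by
  simp only [angularFlow_eq hc hpos]
  refine Continuous.add (by fun_prop) (continuous_torusProj.comp ?_)
  exact (continuous_linearTime hc hpos).smul (by fun_prop)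

/-- Rescaling time in a solution rescales its frequency; uniqueness does the rest. This makes large
times and large frequencies interchangeable. -/
theorem angularFlow_smul (c : ℝ) (w : Euc N) (t : ℝ) (θ : Torus N) :
    angularFlow m (c • w) t θ = angularFlow m w (c * t) θ := by
  have h : IsAngularMotion m (c • w) θ fun t => angularFlow m w (c * t) θ := by
    obtain ⟨h0, x, hx, hd⟩ := isAngularMotion_angularFlow hc hpos w θ
    refine ⟨by simpa using h0, fun t => x (c * t), fun t => hx (c * t), fun t => ?_⟩
    have h1 := (hd (c * t)).scomp t ((hasDerivAt_id t).const_mul c)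
    rw [mul_one, smul_comm] at h1
    exact h1
  exact congrFun ((existsUnique_angularMotion hc hpos (c • w) θ).unique
    (isAngularMotion_angularFlow hc hpos (c • w) θ) h) t

theorem integral_rho_pos : 0 < ∫ θ, rho m θ := by
  have hcr := continuous_rho hc hpos
  refine hcr.integral_pos_of_hasCompactSupport_nonneg_nonzero
    (HasCompactSupport.of_compactSpace _) (fun θ => (rho_pos hpos θ).le) (x := 0) (rho_pos hpos _).ne'

/-- Substitution u = `linearTime m w θ s`, whose derivative is 1/ρ along the line. -/
theorem integral_angularFlow (w : Euc N) (θ : Torus N) (g : C(Torus N, ℝ)) (T : ℝ) :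
    ∫ s in (0 : ℝ)..T, g (angularFlow m w s θ) =
      ∫ u in (0 : ℝ)..linearTime m w θ T,
        g (θ + torusProj (u • w)) * rho m (θ + torusProj (u • w)) := by
  have hcl : Continuous (linearTime m w θ) :=
    continuous_iff_continuousAt.2 fun t => (hasDerivAt_linearTime hc hpos w θ t).continuousAt
  have hr := continuous_comp_linear_flow ⟨rho m, continuous_rho hc hpos⟩ θ w
  have hr' : Continuous fun t => (rho m (θ + torusProj (linearTime m w θ t • w)))⁻¹ :=
    (hr.comp hcl).inv₀ fun t => (rho_pos hpos _).ne'
  have hg : Continuous fun u : ℝ => g (θ + torusProj (u • w)) * rho m (θ + torusProj (u • w)) :=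
    (continuous_comp_linear_flow g θ w).mul hr
  have h := intervalIntegral.integral_comp_mul_deriv (a := 0) (b := T)
    (f := linearTime m w θ)
    (f' := fun t => (rho m (θ + torusProj (linearTime m w θ t • w)))⁻¹)
    (g := fun u => g (θ + torusProj (u • w)) * rho m (θ + torusProj (u • w)))
    (fun t _ => hasDerivAt_linearTime hc hpos w θ t) hr'.continuousOn hg
  rw [linearTime_zero hc hpos] at h
  rw [← h]
  refine intervalIntegral.integral_congr fun s _ => ?_
  simp only [Function.comp_apply, angularFlow_eq hc hpos]
  exact (mul_inv_cancel_right₀ (rho_pos hpos _).ne' _).symm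

/-- Unique ergodicity of the weighted flow with rationally independent frequencies. -/
theorem tendsto_mean_angularFlow {w : Euc N}
    (hw : ∀ n : Fin N → ℤ, n ≠ 0 → inner ℝ (intVec n) w ≠ 0) (θ : Torus N) (g : C(Torus N, ℝ)) :
    Tendsto (fun T : ℝ => T⁻¹ * ∫ s in (0 : ℝ)..T, g (angularFlow m w s θ)) atTop
      (𝓝 ((∫ η, g η * rho m η) / ∫ η, rho m η)) := by
  let r : C(Torus N, ℝ) := ⟨rho m, continuous_rho hc hpos⟩
  have hV : (volume : Measure (Torus N)).real Set.univ ≠ 0 := by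
    rw [measureReal_def]
    exact (ENNReal.toReal_pos (isOpen_univ.measure_pos _ ⟨0, trivial⟩).ne' (measure_lt_top _ _).ne).ne'
  have h1 := (tendsto_mean_linear_flow hw θ (g * r)).comp (tendsto_linearTime hc hpos w θ)
  have h2 := (tendsto_mean_linear_flow hw θ r).comp (tendsto_linearTime hc hpos w θ)
  have hr0 : (⨍ η, r η) ≠ 0 := by
    rw [average_eq]
    exact smul_ne_zero (inv_ne_zero hV) (integral_rho_pos hc hpos).ne'
  have h3 := h1.div h2 hr0
  have hlim : (⨍ η, (g * r) η) / (⨍ η, r η) = (∫ η, g η * rho m η) / ∫ η, rho m η := by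
    rw [average_eq, average_eq, smul_eq_mul, smul_eq_mul, mul_div_mul_left _ _ (inv_ne_zero hV)]
    rfl
  rw [hlim] at h3
  refine h3.congr' ?_
  filter_upwards [(tendsto_linearTime hc hpos w θ).eventually_gt_atTop 0] with T hT
  -- The unnormalised mean of ρ is exactly T, so in the quotient of the two linear means only the
  -- weighted time mean remains.
  have hden : ∫ s in (0 : ℝ)..linearTime m w θ T, r (θ + torusProj (s • w)) = T :=
    travelTime_linearTime hc hpos w θ T
  have hnum := integral_angularFlow hc hpos w θ g T
  simp only [Function.comp_apply, Pi.div_apply, hden]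
  rw [mul_div_mul_left _ _ (inv_ne_zero hT.ne'), div_eq_inv_mul, hnum]
  rfl

end

/-! ### From means along rays to weak limits under dilation -/

section

variable {E : Type*} [NormedAddCommGroup E] [NormedSpace ℝ E] [FiniteDimensional ℝ E]
  [MeasurableSpace E] [BorelSpace E] {μ : Measure E} [μ.IsAddHaarMeasure]

/-- Dilations act continuously on `L¹`. -/
theorem tendsto_integral_norm_dilation_sub {g : E → ℝ} (hg : Continuous g)
    (hgs : HasCompactSupport g) :
    Tendsto (fun c : ℝ => ∫ w, ‖c ^ Module.finrank ℝ E * g (c • w) - g w‖ ∂μ) (𝓝[≥] 1) (𝓝 0) := by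
  obtain ⟨R, hR⟩ := hgs.isCompact.isBounded.subset_closedBall 0
  obtain ⟨C, hC⟩ := hgs.exists_bound_of_continuous hg
  have hC0 : 0 ≤ C := (norm_nonneg _).trans (hC 0)
  have hz : ∀ w, w ∉ Metric.closedBall (0 : E) R → g w = 0 := fun w hw =>
    image_eq_zero_of_notMem_tsupport fun h => hw (hR h)
  have h0 : (0 : ℝ) = ∫ w, (0 : ℝ) ∂μ := by simp
  rw [h0]
  -- For c ≥ 1 the support of g(c ·) stays in the ball of radius R, and c ≤ 2 bounds the Jacobian
  -- factor; hence the one-sided neighbourhood of 1.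
  refine tendsto_integral_filter_of_dominated_convergence
    ((Metric.closedBall (0 : E) R).indicator fun _ => 2 ^ Module.finrank ℝ E * C + C) ?_ ?_ ?_ ?_
  · refine Eventually.of_forall fun c => Continuous.aestronglyMeasurable ?_
    fun_prop
  · have h2 : ∀ᶠ c : ℝ in 𝓝[≥] 1, c ≤ 2 :=
      nhdsWithin_le_nhds (eventually_le_nhds (by norm_num))
    filter_upwards [self_mem_nhdsWithin, h2] with c hc1 hc2
    have hc1 : (1 : ℝ) ≤ c := hc1
    refine Eventually.of_forall fun w => ?_
    by_cases hw : w ∈ Metric.closedBall (0 : E) R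
    · rw [Set.indicator_of_mem hw, norm_norm]
      refine (norm_sub_le _ _).trans (add_le_add ?_ (hC _))
      rw [norm_mul, norm_pow, Real.norm_eq_abs, abs_of_nonneg (by linarith)]
      gcongr
      exact hC _
    · rw [Set.indicator_of_notMem hw, hz w hw, hz (c • w)]
      · simp
      · intro h
        refine hw ?_
        rw [mem_closedBall_zero_iff] at h ⊢
        rw [norm_smul, Real.norm_eq_abs, abs_of_nonneg (by linarith)] at h
        nlinarith [norm_nonneg w]
  · rw [integrable_indicator_iff Metric.isClosed_closedBall.measurableSet]
    exact integrableOn_const (isCompact_closedBall _ _).measure_lt_top.ne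
  · refine Eventually.of_forall fun w => ?_
    have hcont : Continuous fun c : ℝ => ‖c ^ Module.finrank ℝ E * g (c • w) - g w‖ := by fun_prop
    have := (hcont.tendsto 1).mono_left (nhdsWithin_le_nhds (s := Set.Ici 1))
    simpa using this

/-- The average over [t, (1 + d)t] is a combination of the means up to (1 + d)t and up to t, with
weights (1 + d)/d and -1/d. -/
theorem tendsto_mean_dilated {f : ℝ → ℝ} (hf : ∀ a b, IntervalIntegrable f volume a b) {M : ℝ}
    (h : Tendsto (fun T : ℝ => T⁻¹ * ∫ s in (0 : ℝ)..T, f s) atTop (𝓝 M)) {d : ℝ} (hd : 0 < d) :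
    Tendsto (fun t : ℝ => d⁻¹ * ∫ c in (1 : ℝ)..(1 + d), f (t * c)) atTop (𝓝 M) := by
  have h1 : Tendsto (fun t : ℝ => t * (1 + d)) atTop atTop :=
    tendsto_id.atTop_mul_const (by linarith)
  have h2 := (((h.comp h1).const_mul (1 + d)).sub h).const_mul d⁻¹
  have h3 : d⁻¹ * ((1 + d) * M - M) = M := by field_simp; ring
  rw [h3] at h2
  refine h2.congr' ?_
  filter_upwards [eventually_gt_atTop 0] with t ht
  rw [intervalIntegral.integral_comp_mul_left _ ht.ne', smul_eq_mul, mul_one,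
    ← intervalIntegral.integral_interval_sub_left (hf 0 _) (hf 0 t)]
  simp only [Function.comp]
  have : 1 + d ≠ 0 := by linarith
  field_simp

/-- If the bounded function `F` has mean `M` along almost every ray, then `F (t ·) → M` weakly. -/
theorem tendsto_integral_mul_dilation {F : E → ℝ} (hF : Measurable F) {C : ℝ}
    (hC : ∀ w, |F w| ≤ C) {M : ℝ}
    (hM : ∀ᵐ w ∂μ, Tendsto (fun T : ℝ => T⁻¹ * ∫ s in (0 : ℝ)..T, F (s • w)) atTop (𝓝 M))
    {g : E → ℝ} (hg : Integrable g μ) :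
    Tendsto (fun t : ℝ => ∫ w, g w * F (t • w) ∂μ) atTop (𝓝 (M * ∫ w, g w ∂μ)) := by
  have hC0 : 0 ≤ C := (abs_nonneg _).trans (hC 0)
  have hFt : ∀ t : ℝ, Measurable fun w => F (t • w) := fun t => hF.comp (measurable_const_smul t)
  have hint : ∀ {g : E → ℝ} (_ : Integrable g μ) (t : ℝ),
      Integrable (fun w => g w * F (t • w)) μ := fun hg t =>
    hg.mul_bdd (hFt t).aestronglyMeasurable (Eventually.of_forall fun w => hC _)
  have hM0 : ∀ {g : E → ℝ}, Integrable g μ → Continuous g → HasCompactSupport g →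
      Tendsto (fun t : ℝ => ∫ w, g w * F (t • w) ∂μ) atTop (𝓝 (M * ∫ w, g w ∂μ)) := by
    intro g hgi hgc hgs
    rw [Metric.tendsto_atTop]
    intro ε hε
    -- The L¹ error is later multiplied by C; the added 1 covers C = 0.
    have hη : 0 < ε / (2 * (C + 1)) := by positivity
    have hev := (tendsto_integral_norm_dilation_sub (μ := μ) hgc hgs).eventually
      (gt_mem_nhds hη)
    obtain ⟨d, hd, hdsub⟩ : ∃ d > 0, ∀ c ∈ Set.Icc (1 : ℝ) (1 + d),
        ∫ w, ‖c ^ Module.finrank ℝ E * g (c • w) - g w‖ ∂μ < ε / (2 * (C + 1)) := by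
      obtain ⟨u, hu, hsub⟩ := (mem_nhdsGE_iff_exists_Icc_subset).1 hev
      refine ⟨u - 1, sub_pos.2 hu, fun c hc => hsub ?_⟩
      simpa using hc
    have hclose : ∀ t : ℝ, ∀ c ∈ Set.Icc (1 : ℝ) (1 + d),
        |(∫ w, g w * F ((t * c) • w) ∂μ) - ∫ w, g w * F (t • w) ∂μ| ≤ ε / 2 := by
      intro t c hc
      have hc0 : 0 < c := lt_of_lt_of_le one_pos hc.1
      -- Change of variables moves the dilation from F to g, where it is a small L¹ perturbation.
      have hdil : ∫ w, (c ^ Module.finrank ℝ E * g (c • w)) * F ((t * c) • w) ∂μ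
          = ∫ w, g w * F (t • w) ∂μ := by
        have h := Measure.integral_comp_smul μ (fun w => g w * F (t • w)) c
        simp only [smul_smul] at h
        simp only [mul_assoc]
        rw [integral_const_mul, h, abs_of_pos (by positivity), smul_eq_mul,
          mul_inv_cancel_left₀ (by positivity)]
      have hgci : Integrable (fun w => c ^ Module.finrank ℝ E * g (c • w)) μ :=
        ((integrable_comp_smul_iff μ g hc0.ne').2 hgi).const_mul _
      rw [← hdil, ← integral_sub (hint hgi _) (hint hgci _), ← Real.norm_eq_abs]
      refine (norm_integral_le_integral_norm _).trans ?_
      calc ∫ w, ‖g w * F ((t * c) • w) - c ^ Module.finrank ℝ E * g (c • w) * F ((t * c) • w)‖ ∂μ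
          ≤ ∫ w, ‖c ^ Module.finrank ℝ E * g (c • w) - g w‖ * C ∂μ := by
            refine integral_mono ((hint hgi _).sub (hint hgci _)).norm
              ((hgci.sub hgi).norm.mul_const C) fun w => ?_
            simp only
            rw [← sub_mul, norm_mul, norm_sub_rev]
            gcongr
            exact hC _
        _ ≤ ε / (2 * (C + 1)) * C := by
            rw [integral_mul_const]
            exact mul_le_mul_of_nonneg_right (hdsub c hc).le hC0
        _ ≤ ε / 2 := by
            rw [div_mul_eq_mul_div, div_le_div_iff₀ (by positivity) (by positivity)]
            nlinarith
    -- The pairing averaged over dilations c in [1, 1 + d]. It is close to the original pairing by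
    -- `hclose`, and it converges because the inner average is a mean along a ray.
    let A : ℝ → ℝ := fun t => ∫ w, g w * (d⁻¹ * ∫ c in (1 : ℝ)..(1 + d), F ((t * c) • w)) ∂μ
    have hfub : ∀ t, A t = d⁻¹ * ∫ c in (1 : ℝ)..(1 + d), ∫ w, g w * F ((t * c) • w) ∂μ := by
      intro t
      have : IsFiniteMeasure ((volume : Measure ℝ).restrict (Set.uIoc 1 (1 + d))) :=
        ⟨by simp [Set.uIoc]⟩
      have h : Integrable (Function.uncurry fun (c : ℝ) (w : E) => g w * F ((t * c) • w))
          ((volume.restrict (Set.uIoc 1 (1 + d))).prod μ) := by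
        have h1 : Integrable (fun p : ℝ × E => g p.2) ((volume.restrict (Set.uIoc 1 (1 + d))).prod μ) :=
          hgi.comp_snd _
        refine h1.mul_bdd (g := fun p : ℝ × E => F ((t * p.1) • p.2)) (c := C)
          (hF.comp (by fun_prop)).aestronglyMeasurable
          (Eventually.of_forall fun p => hC _)
      rw [intervalIntegral_integral_swap h, ← integral_const_mul]
      refine integral_congr_ae (Eventually.of_forall fun w => ?_)
      simp only [intervalIntegral.integral_const_mul]
      ring
    have hA : Tendsto A atTop (𝓝 (M * ∫ w, g w ∂μ)) := by
      rw [← integral_const_mul]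
      simp only [mul_comm M]
      refine tendsto_integral_filter_of_dominated_convergence (fun w => ‖g w‖ * C) ?_ ?_ ?_ ?_
      · refine Eventually.of_forall fun t => hgi.aestronglyMeasurable.mul ?_
        refine AEStronglyMeasurable.const_mul ?_ _
        simp only [intervalIntegral.integral_of_le (by linarith : (1 : ℝ) ≤ 1 + d)]
        refine StronglyMeasurable.aestronglyMeasurable ?_
        refine StronglyMeasurable.integral_prod_right (f := fun w c => F ((t * c) • w)) ?_
        exact (hF.comp (by fun_prop)).stronglyMeasurable
      · refine Eventually.of_forall fun t => Eventually.of_forall fun w => ?_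
        rw [norm_mul]
        gcongr
        rw [norm_mul, norm_inv, Real.norm_eq_abs, abs_of_pos hd, inv_mul_le_iff₀ hd, mul_comm]
        have h := intervalIntegral.norm_integral_le_of_norm_le_const (a := 1) (b := 1 + d)
          (f := fun c => F ((t * c) • w)) (C := C) (fun s _ => hC _)
        rwa [add_sub_cancel_left, abs_of_pos hd] at h
      · exact hgi.norm.mul_const C
      · filter_upwards [hM] with w hw
        refine Tendsto.const_mul _ ?_
        refine tendsto_mean_dilated (f := fun s => F (s • w)) (fun a b => ?_) hw hd
        refine (intervalIntegrable_const (c := C)).mono_fun'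
          (hF.comp (by fun_prop)).aestronglyMeasurable (Eventually.of_forall fun s => hC _)
    obtain ⟨T, hT⟩ := Metric.tendsto_atTop.1 hA (ε / 2) (by positivity)
    refine ⟨T, fun t ht => ?_⟩
    have h1 : |A t - ∫ w, g w * F (t • w) ∂μ| ≤ ε / 2 := by
      have hii : IntervalIntegrable (fun c => ∫ w, g w * F ((t * c) • w) ∂μ) volume 1 (1 + d) := by
        refine (intervalIntegrable_const (c := (∫ w, ‖g w‖ ∂μ) * C)).mono_fun' ?_ ?_
        · refine StronglyMeasurable.aestronglyMeasurable ?_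
          refine StronglyMeasurable.integral_prod_right (f := fun c w => g w * F ((t * c) • w)) ?_
          exact ((hgc.measurable.comp measurable_snd).mul
            (hF.comp (by fun_prop))).stronglyMeasurable
        · refine Eventually.of_forall fun c => ?_
          simp only
          rw [← integral_mul_const]
          refine norm_integral_le_of_norm_le (hgi.norm.mul_const C) (Eventually.of_forall fun w => ?_)
          rw [norm_mul]
          gcongr
          exact hC _
      have h2 : A t - ∫ w, g w * F (t • w) ∂μ = d⁻¹ * ∫ c in (1 : ℝ)..(1 + d),
          ((∫ w, g w * F ((t * c) • w) ∂μ) - ∫ w, g w * F (t • w) ∂μ) := by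
        rw [intervalIntegral.integral_sub hii intervalIntegrable_const, hfub, mul_sub,
          intervalIntegral.integral_const, add_sub_cancel_left, smul_eq_mul,
          inv_mul_cancel_left₀ hd.ne']
      rw [h2, abs_mul, abs_inv, abs_of_pos hd, inv_mul_le_iff₀ hd, mul_comm]
      have h := intervalIntegral.norm_integral_le_of_norm_le_const (a := 1) (b := 1 + d)
          (f := fun c => (∫ w, g w * F ((t * c) • w) ∂μ) - ∫ w, g w * F (t • w) ∂μ)
          (C := ε / 2) (fun c hc => hclose t c ?_)
      · rwa [add_sub_cancel_left, abs_of_pos hd] at h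
      · rw [Set.uIoc_of_le (by linarith)] at hc
        exact ⟨hc.1.le, hc.2⟩
    have h3 := hT t ht
    rw [Real.dist_eq] at h3 ⊢
    rw [abs_lt] at h3 ⊢
    rw [abs_le] at h1
    constructor <;> linarith [h1.1, h1.2, h3.1, h3.2]
  rw [Metric.tendsto_atTop]
  intro ε hε
  -- Replacing g by k costs at most C times the L¹ error in the pairing and |M| times it in the
  -- limit.
  obtain ⟨k, hks, hk, hkc, hki⟩ := hg.exists_hasCompactSupport_integral_sub_le
    (ε := ε / (3 * (C + |M| + 1))) (by positivity)
  obtain ⟨T, hT⟩ := Metric.tendsto_atTop.1 (hM0 hki hkc hks) (ε / 3) (by positivity)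
  refine ⟨T, fun t ht => ?_⟩
  have hsmall : ∀ B, 0 ≤ B → B ≤ C + |M| → (∫ w, ‖g w - k w‖ ∂μ) * B ≤ ε / 3 := by
    intro B hB hB2
    refine (mul_le_mul_of_nonneg_right hk hB).trans ?_
    rw [div_mul_eq_mul_div, div_le_div_iff₀ (by positivity) (by positivity)]
    nlinarith
  have h1 : |(∫ w, g w * F (t • w) ∂μ) - ∫ w, k w * F (t • w) ∂μ| ≤ ε / 3 := by
    rw [← integral_sub (hint hg t) (hint hki t), ← Real.norm_eq_abs]
    refine le_trans ?_ (hsmall C hC0 (by linarith [abs_nonneg M]))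
    rw [← integral_mul_const]
    refine norm_integral_le_of_norm_le ((hg.sub hki).norm.mul_const C)
      (Eventually.of_forall fun w => ?_)
    rw [← sub_mul, norm_mul]
    gcongr
    exact hC _
  have h2 : |M * (∫ w, k w ∂μ) - M * ∫ w, g w ∂μ| ≤ ε / 3 := by
    rw [← mul_sub, abs_mul, abs_sub_comm, ← integral_sub hg hki, mul_comm]
    refine le_trans ?_ (hsmall |M| (abs_nonneg M) (by linarith))
    exact mul_le_mul_of_nonneg_right (norm_integral_le_integral_norm fun w => g w - k w)
      (abs_nonneg M)
  have h3 := hT t ht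
  rw [Real.dist_eq] at h3 ⊢
  rw [abs_lt] at h3 ⊢
  rw [abs_le] at h1 h2
  constructor <;> linarith [h1.1, h1.2, h2.1, h2.2, h3.1, h3.2]

end

/-! ### Mixing of the weighted flow -/

section

variable {N : ℕ} {m : Torus N → ℝ}

theorem integrable_torus (f : C(Torus N, ℝ)) : Integrable f :=
  f.continuous.integrable_of_hasCompactSupport (HasCompactSupport.of_compactSpace f)

theorem norm_integral_mul_rho_div_le (hc : Continuous m) (hpos : ∀ θ, 0 < m θ)
    (f : C(Torus N, ℝ)) : ‖(∫ θ, f θ * rho m θ) / ∫ θ, rho m θ‖ ≤ ‖f‖ := by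
  have h : ‖∫ θ, f θ * rho m θ‖ ≤ ∫ θ, ‖f‖ * rho m θ := by
    refine norm_integral_le_of_norm_le
      ((integrable_torus ⟨rho m, continuous_rho hc hpos⟩).const_mul ‖f‖)
      (Eventually.of_forall fun θ => ?_)
    rw [norm_mul, Real.norm_of_nonneg (rho_pos hpos θ).le]
    exact mul_le_mul_of_nonneg_right (f.norm_coe_le_norm θ) (rho_pos hpos θ).le
  have hr := integral_rho_pos hc hpos
  rw [integral_const_mul] at h
  rwa [norm_div, Real.norm_of_nonneg hr.le, div_le_iff₀ hr]

/-- The average of a continuous function on the torus with respect to `ρ(θ) dθ`. -/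
noncomputable def rhoMean (hc : Continuous m) (hpos : ∀ θ, 0 < m θ) : C(Torus N, ℝ) →L[ℝ] ℝ :=
  have hi : ∀ f : C(Torus N, ℝ), Integrable fun θ => f θ * rho m θ := fun f =>
    integrable_torus (f * ⟨rho m, continuous_rho hc hpos⟩)
  LinearMap.mkContinuous
    { toFun := fun f => (∫ θ, f θ * rho m θ) / ∫ θ, rho m θ
      map_add' := fun f g => by
        simp only [ContinuousMap.add_apply, add_mul, integral_add (hi f) (hi g), add_div]
      map_smul' := fun c f => by
        simp only [ContinuousMap.smul_apply, smul_eq_mul, mul_assoc, integral_const_mul,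
          mul_div_assoc, RingHom.id_apply] } 1
    fun f => (norm_integral_mul_rho_div_le hc hpos f).trans_eq (one_mul _).symm

theorem rhoMean_apply (hc : Continuous m) (hpos : ∀ θ, 0 < m θ) (f : C(Torus N, ℝ)) :
    rhoMean hc hpos f = (∫ θ, f θ * rho m θ) / ∫ θ, rho m θ := rfl

theorem norm_rhoMean_le (hc : Continuous m) (hpos : ∀ θ, 0 < m θ) (f : C(Torus N, ℝ)) :
    ‖rhoMean hc hpos f‖ ≤ ‖f‖ := norm_integral_mul_rho_div_le hc hpos f

variable (hc : Continuous m) (hpos : ∀ θ, 0 < m θ)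

include hc hpos

theorem measurable_angularFlow_comp {X : Type*} [MeasurableSpace X] {ω : X → Euc N}
    (hω : Measurable ω) {β : X → Torus N} (hβ : Measurable β) (t : ℝ) :
    Measurable fun x => angularFlow m (ω x) t (β x) :=
  (continuous_angularFlow hc hpos).measurable.comp
    ((hω.prodMk hβ).prodMk measurable_const)

/-- Mixing for observables of the angle and a finite measure of frequencies. -/
theorem tendsto_integral_angularFlow {X : Type*} [MeasurableSpace X] {ν : Measure X}
    [IsFiniteMeasure ν] {ω : X → Euc N} (hω : Measurable ω) (hac : ν.map ω ≪ volume)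
    (θ : Torus N) (c : C(Torus N, ℝ)) :
    Tendsto (fun t : ℝ => ∫ x, c (angularFlow m (ω x) t θ) ∂ν) atTop
      (𝓝 (rhoMean hc hpos c * ν.real Set.univ)) := by
  have hF : Measurable fun w => c (angularFlow m w 1 θ) :=
    c.continuous.measurable.comp
      (measurable_angularFlow_comp hc hpos measurable_id measurable_const 1)
  have hsc : ∀ (t : ℝ) w, angularFlow m (t • w) 1 θ = angularFlow m w t θ := fun t w => by
    rw [angularFlow_smul hc hpos, mul_one]
  -- Here F is the observable at time 1 as a function of frequency, and g is the density of the law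
  -- of frequencies.
  have key := tendsto_integral_mul_dilation (μ := (volume : Measure (Euc N))) hF
    (C := ‖c‖) (fun w => c.norm_coe_le_norm _) (M := rhoMean hc hpos c) ?_
    (g := fun w => ((ν.map ω).rnDeriv volume w).toReal) Measure.integrable_toReal_rnDeriv
  · have h1 : ∫ w, ((ν.map ω).rnDeriv volume w).toReal = ν.real Set.univ := by
      rw [Measure.integral_toReal_rnDeriv hac, measureReal_def, Measure.map_apply hω .univ,
        Set.preimage_univ, measureReal_def]
    rw [h1] at key
    refine key.congr fun t => ?_
    rw [integral_toReal_rnDeriv_mul hac, integral_map hω.aemeasurable]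
    · simp only [hsc]
    · exact (hF.comp (measurable_const_smul t)).aestronglyMeasurable
  · filter_upwards [ae_rationally_independent N] with w hw
    simp only [hsc]
    exact tendsto_mean_angularFlow hc hpos hw θ c

theorem integrable_apply_angularFlow {X : Type*} [MeasurableSpace X] {ν : Measure X}
    {ω : X → Euc N} (hω : Measurable ω) (θ : Torus N) {K : X → C(Torus N, ℝ)}
    (hK : Integrable K ν) (t : ℝ) : Integrable (fun x => K x (angularFlow m (ω x) t θ)) ν := by
  refine hK.norm.mono' ?_ (Eventually.of_forall fun x => (K x).norm_coe_le_norm _)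
  have h : Continuous fun p : C(Torus N, ℝ) × Torus N => p.1 p.2 := by fun_prop
  exact h.comp_aestronglyMeasurable (hK.aestronglyMeasurable.prodMk
    (measurable_angularFlow_comp hc hpos hω measurable_const t).aestronglyMeasurable)

/-- Mixing for integrable families of observables of the angle. -/
theorem tendsto_integral_apply_angularFlow {X : Type*} [MeasurableSpace X] {ν : Measure X}
    {ω : X → Euc N} (hω : Measurable ω) (hac : ν.map ω ≪ volume)
    (θ : Torus N) {K : X → C(Torus N, ℝ)} (hK : Integrable K ν) :
    Tendsto (fun t : ℝ => ∫ x, K x (angularFlow m (ω x) t θ) ∂ν) atTop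
      (𝓝 (∫ x, rhoMean hc hpos (K x) ∂ν)) := by
  have hint := fun {K : X → C(Torus N, ℝ)} (hK : Integrable K ν) =>
    integrable_apply_angularFlow hc hpos hω θ hK
  have hmean := fun {K : X → C(Torus N, ℝ)} (hK : Integrable K ν) =>
    (rhoMean hc hpos).integrable_comp hK
  refine Integrable.induction (P := fun K : X → C(Torus N, ℝ) =>
    Tendsto (fun t : ℝ => ∫ x, K x (angularFlow m (ω x) t θ) ∂ν) atTop
      (𝓝 (∫ x, rhoMean hc hpos (K x) ∂ν))) ?_ ?_ ?_ ?_ hK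
  · intro c s hs hνs
    have : IsFiniteMeasure (ν.restrict s) := ⟨by simpa using hνs⟩
    have h := tendsto_integral_angularFlow hc hpos (ν := ν.restrict s) hω
      ((Measure.map_mono Measure.restrict_le_self hω).absolutelyContinuous.trans hac) θ c
    have h1 : ∫ x, rhoMean hc hpos (s.indicator (fun _ => c) x) ∂ν
        = rhoMean hc hpos c * (ν.restrict s).real Set.univ := by
      have h2 : (fun x => rhoMean hc hpos (s.indicator (fun _ => c) x))
          = s.indicator fun _ => rhoMean hc hpos c := by
        ext x; by_cases hx : x ∈ s <;> simp [hx]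
      rw [h2, integral_indicator hs, integral_const, smul_eq_mul, mul_comm]
    rw [h1]
    refine h.congr fun t => ?_
    rw [← integral_indicator hs]
    congr 1
    ext x
    by_cases hx : x ∈ s <;> simp [hx]
  · intro f g _ hf hg hPf hPg
    have h1 : ∫ x, rhoMean hc hpos ((f + g) x) ∂ν
        = ∫ x, rhoMean hc hpos (f x) ∂ν + ∫ x, rhoMean hc hpos (g x) ∂ν := by
      simp only [Pi.add_apply, map_add]
      exact integral_add (hmean hf) (hmean hg)
    rw [h1]
    refine (hPf.add hPg).congr fun t => ?_
    exact (integral_add (hint hf t) (hint hg t)).symm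
  -- Both the integral at time t and the limit are 1-Lipschitz in K for the L¹ norm, uniformly in t.
  · refine isClosed_of_closure_subset fun f hf => ?_
    rw [Set.mem_ofPred_eq, Metric.tendsto_atTop]
    intro ε hε
    obtain ⟨g, hPg, hg⟩ := Metric.mem_closure_iff.1 hf (ε / 3) (by positivity)
    obtain ⟨T, hT⟩ := Metric.tendsto_atTop.1 hPg (ε / 3) (by positivity)
    have hfi := L1.integrable_coeFn f
    have hgi := L1.integrable_coeFn g
    rw [L1.dist_eq_integral_dist] at hg
    have hdi : Integrable (fun x => dist (f x) (g x)) ν := by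
      simp only [dist_eq_norm]; exact (hfi.sub hgi).norm
    refine ⟨T, fun t ht => ?_⟩
    have h1 : dist (∫ x, f x (angularFlow m (ω x) t θ) ∂ν)
        (∫ x, g x (angularFlow m (ω x) t θ) ∂ν) ≤ ∫ x, dist (f x) (g x) ∂ν := by
      rw [dist_eq_norm, ← integral_sub (hint hfi t) (hint hgi t)]
      refine norm_integral_le_of_norm_le hdi (Eventually.of_forall fun x => ?_)
      rw [dist_eq_norm]
      exact (f x - g x).norm_coe_le_norm _
    have h2 : dist (∫ x, rhoMean hc hpos (g x) ∂ν) (∫ x, rhoMean hc hpos (f x) ∂ν)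
        ≤ ∫ x, dist (f x) (g x) ∂ν := by
      rw [dist_comm, dist_eq_norm, ← integral_sub (hmean hfi) (hmean hgi)]
      refine norm_integral_le_of_norm_le hdi (Eventually.of_forall fun x => ?_)
      rw [dist_eq_norm, ← map_sub]
      exact norm_rhoMean_le hc hpos _
    have h3 := dist_triangle4 (∫ x, f x (angularFlow m (ω x) t θ) ∂ν)
      (∫ x, g x (angularFlow m (ω x) t θ) ∂ν) (∫ x, rhoMean hc hpos (g x) ∂ν)
      (∫ x, rhoMean hc hpos (f x) ∂ν)
    linarith [hT t ht]
  · intro f g hfg _ hPf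
    have h1 : ∫ x, rhoMean hc hpos (f x) ∂ν = ∫ x, rhoMean hc hpos (g x) ∂ν :=
      integral_congr_ae (hfg.fun_comp (rhoMean hc hpos))
    rw [← h1]
    refine hPf.congr fun t => integral_congr_ae ?_
    filter_upwards [hfg] with x hx
    rw [hx]

/-- Mixing of the weighted flow on phase space, for integrable densities and bounded continuous
observables. -/
theorem tendsto_integral_mul_phaseFlow {ν : Measure (Euc N)} [SFinite ν] {H : Euc N → ℝ}
    (hac : ν.map (gradient H) ≪ volume) {f : Euc N × Torus N → ℝ}
    (hf : Integrable f (ν.prod volume)) (G : BoundedContinuousFunction (Euc N × Torus N) ℝ) :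
    Tendsto (fun t : ℝ => ∫ z, f z * G (phaseFlow m H t z) ∂(ν.prod volume)) atTop
      (𝓝 (∫ z, f z * rhoMean hc hpos (G.toContinuousMap.curry z.1) ∂(ν.prod volume))) := by
  have hω := measurable_gradient H
  have hcurry : ∀ I, ‖G.toContinuousMap.curry I‖ ≤ ‖G‖ := fun I =>
    (ContinuousMap.norm_le _ (norm_nonneg _)).2 fun θ => G.norm_coe_le_norm (I, θ)
  have hflow : ∀ t, Measurable (phaseFlow m H t) := fun t =>
    measurable_fst.prodMk (measurable_angularFlow_comp hc hpos (hω.comp measurable_fst)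
      measurable_snd t)
  have hi1 : ∀ t, Integrable (fun z => f z * G (phaseFlow m H t z)) (ν.prod volume) := fun t =>
    hf.mul_bdd (c := ‖G‖) (G.continuous.measurable.comp (hflow t)).aestronglyMeasurable
      (Eventually.of_forall fun z => G.norm_coe_le_norm _)
  have hi2 : Integrable (fun z => f z * rhoMean hc hpos (G.toContinuousMap.curry z.1))
      (ν.prod volume) := by
    refine hf.mul_bdd (c := ‖G‖) (Continuous.aestronglyMeasurable ?_)
      (Eventually.of_forall fun z => (norm_rhoMean_le hc hpos _).trans (hcurry _))
    exact (rhoMean hc hpos).continuous.comp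
      (G.toContinuousMap.curry.continuous.comp continuous_fst)
  -- The initial angle becomes the outer variable, so that mixing in the action applies for each
  -- fixed angle.
  simp only [fun t => integral_prod_symm _ (hi1 t), integral_prod_symm _ hi2]
  refine tendsto_integral_filter_of_dominated_convergence
    (fun θ => (∫ I, ‖f (I, θ)‖ ∂ν) * ‖G‖) ?_ ?_ ?_ ?_
  · exact Eventually.of_forall fun t => (hi1 t).integral_prod_right.aestronglyMeasurable
  · refine Eventually.of_forall fun t => ?_
    filter_upwards [hf.prod_left_ae] with θ hθ
    rw [← integral_mul_const]
    refine norm_integral_le_of_norm_le (hθ.norm.mul_const _) (Eventually.of_forall fun I => ?_)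
    rw [norm_mul]
    gcongr
    exact G.norm_coe_le_norm _
  · exact hf.norm.integral_prod_right.mul_const _
  · filter_upwards [hf.prod_left_ae] with θ hθ
    -- With the initial angle frozen, the density value is a scalar weight on the observable I ↦
    -- G(I, ·).
    have hK : Integrable (fun I => f (I, θ) • G.toContinuousMap.curry I) ν := by
      refine (hθ.norm.mul_const ‖G‖).mono' (hθ.aestronglyMeasurable.smul
        G.toContinuousMap.curry.continuous.aestronglyMeasurable)
        (Eventually.of_forall fun I => ?_)
      rw [norm_smul]
      gcongr
      exact hcurry I
    have h := tendsto_integral_apply_angularFlow hc hpos hω hac θ hK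
    simp only [map_smul, smul_eq_mul, ContinuousMap.smul_apply] at h
    exact h

end

/-! ### Ensemble and equilibrium as integrals over phase space -/

theorem volume_restrict_prod_univ {N : ℕ} (Ω : Set (Euc N)) :
    (volume : Measure (Euc N × Torus N)).restrict (Ω ×ˢ Set.univ)
      = (volume.restrict Ω).prod volume := by
  rw [Measure.volume_eq_prod, ← Measure.prod_restrict, Measure.restrict_univ]

/-- A function that is continuous on `Ω̄ × 𝕋^N` with `Ω` bounded extends to a bounded continuous
function. -/
theorem exists_boundedContinuous_extension {N : ℕ} {Ω : Set (Euc N)} (hb : Bornology.IsBounded Ω)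
    {G : Euc N × Torus N → ℝ} (hG : ContinuousOn G (closure Ω ×ˢ Set.univ)) :
    ∃ G' : BoundedContinuousFunction (Euc N × Torus N) ℝ,
      ∀ z ∈ closure Ω ×ˢ (Set.univ : Set (Torus N)), G' z = G z := by
  have hK : IsCompact (closure Ω ×ˢ (Set.univ : Set (Torus N))) :=
    hb.isCompact_closure.prod isCompact_univ
  have : CompactSpace (closure Ω ×ˢ (Set.univ : Set (Torus N)) : Set _) :=
    isCompact_iff_compactSpace.1 hK
  -- Tietze extension from a compact, hence closed, set.
  obtain ⟨G', -, h⟩ := BoundedContinuousFunction.exists_norm_eq_domRestrict_eq_of_closed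
    (BoundedContinuousFunction.mkOfCompact ⟨_, hG.domRestrict⟩) hK.isClosed
  refine ⟨G', fun z hz => ?_⟩
  exact congrArg (fun k => k ⟨z, hz⟩) h

section

variable {N : ℕ} {Ω : Set (Euc N)} {m : Torus N → ℝ} {H : Euc N → ℝ}
  {f₀ : Euc N × Torus N → ℝ}

theorem integrable_density (hc : Continuous m) (hpos : ∀ θ, 0 < m θ)
    (hf : IntegrableOn f₀ (Ω ×ˢ Set.univ)) :
    Integrable (fun z => f₀ z * rho m z.2) ((volume.restrict Ω).prod volume) := by
  rw [IntegrableOn, volume_restrict_prod_univ] at hf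
  refine hf.mul_bdd (c := ‖(⟨rho m, continuous_rho hc hpos⟩ : C(Torus N, ℝ))‖) ?_ ?_
  · exact ((continuous_rho hc hpos).comp continuous_snd).aestronglyMeasurable
  · exact Eventually.of_forall fun z =>
      (⟨rho m, continuous_rho hc hpos⟩ : C(Torus N, ℝ)).norm_coe_le_norm z.2

theorem muStar_withDensity (hc : Continuous m) (hpos : ∀ θ, 0 < m θ)
    (hf : IntegrableOn f₀ (Ω ×ˢ Set.univ)) :
    (muStar Ω m).withDensity (fun z => ENNReal.ofReal (f₀ z))
      = ((volume.restrict Ω).prod volume).withDensity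
          fun z => ENNReal.ofReal (f₀ z * rho m z.2) := by
  rw [IntegrableOn, volume_restrict_prod_univ] at hf
  have h1 : Measurable fun z : Euc N × Torus N => ENNReal.ofReal (rho m z.2) :=
    ((continuous_rho hc hpos).comp continuous_snd).measurable.ennreal_ofReal
  rw [muStar, volume_restrict_prod_univ, ← withDensity_mul₀ h1.aemeasurable
    hf.aestronglyMeasurable.aemeasurable.ennreal_ofReal]
  congr 1
  ext z
  rw [Pi.mul_apply, mul_comm (f₀ z), ENNReal.ofReal_mul (rho_pos hpos _).le]

theorem measurable_phaseFlow (hc : Continuous m) (hpos : ∀ θ, 0 < m θ) (H : Euc N → ℝ) (t : ℝ) :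
    Measurable (phaseFlow m H t) :=
  measurable_fst.prodMk (measurable_angularFlow_comp hc hpos
    ((measurable_gradient H).comp measurable_fst) measurable_snd t)

/-- The flow fixes the action, so mass that starts over Ω stays over Ω. -/
theorem ae_ensemble_mem (hΩ : MeasurableSet Ω) (hc : Continuous m) (hpos : ∀ θ, 0 < m θ) (t : ℝ) :
    ∀ᵐ z ∂(ensemble Ω m H f₀ t), z ∈ Ω ×ˢ (Set.univ : Set (Torus N)) := by
  have hm : MeasurableSet (Ω ×ˢ (Set.univ : Set (Torus N))) := hΩ.prod .univ
  refine (ae_map_iff (measurable_phaseFlow hc hpos H t).aemeasurable hm).2 ?_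
  refine ((withDensity_absolutelyContinuous _ _).trans
    (withDensity_absolutelyContinuous _ _)).ae_le ?_
  filter_upwards [ae_restrict_mem hm] with z hz
  exact ⟨hz.1, trivial⟩

theorem ae_equilibrium_mem (hΩ : MeasurableSet Ω) :
    ∀ᵐ z ∂(equilibrium Ω m f₀), z ∈ Ω ×ˢ (Set.univ : Set (Torus N)) := by
  have h : ∀ᵐ I ∂((volume.restrict Ω).withDensity
      fun I => ENNReal.ofReal (actionMarginal m f₀ I)), I ∈ Ω :=
    (withDensity_absolutelyContinuous _ _).ae_le (ae_restrict_mem hΩ)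
  filter_upwards [Measure.quasiMeasurePreserving_fst.ae h] with z hz
  exact ⟨hz, trivial⟩

theorem isFiniteMeasure_ensemble (hc : Continuous m) (hpos : ∀ θ, 0 < m θ)
    (hf : IntegrableOn f₀ (Ω ×ˢ Set.univ)) (t : ℝ) : IsFiniteMeasure (ensemble Ω m H f₀ t) := by
  have := isFiniteMeasure_withDensity_ofReal (integrable_density hc hpos hf).2
  rw [ensemble, muStar_withDensity hc hpos hf]
  infer_instance

theorem integral_ensemble (hc : Continuous m) (hpos : ∀ θ, 0 < m θ)
    (hf : IntegrableOn f₀ (Ω ×ˢ Set.univ))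
    (hf0 : ∀ᵐ z ∂((volume : Measure (Euc N × Torus N)).restrict (Ω ×ˢ Set.univ)), 0 ≤ f₀ z)
    (t : ℝ) {G : Euc N × Torus N → ℝ} (hG : Continuous G) :
    ∫ z, G z ∂(ensemble Ω m H f₀ t)
      = ∫ z, (f₀ z * rho m z.2) * G (phaseFlow m H t z) ∂((volume.restrict Ω).prod volume) := by
  rw [ensemble, integral_map (measurable_phaseFlow hc hpos H t).aemeasurable
    hG.aestronglyMeasurable, muStar_withDensity hc hpos hf,
    integral_withDensity_eq_integral_toReal_smul₀
      (integrable_density hc hpos hf).aestronglyMeasurable.aemeasurable.ennreal_ofReal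
      (Eventually.of_forall fun _ => ENNReal.ofReal_lt_top)]
  rw [volume_restrict_prod_univ] at hf0
  refine integral_congr_ae ?_
  filter_upwards [hf0] with z hz
  rw [ENNReal.toReal_ofReal (mul_nonneg hz (rho_pos hpos _).le), smul_eq_mul]

theorem integrable_actionMarginal (hc : Continuous m) (hpos : ∀ θ, 0 < m θ)
    (hf : IntegrableOn f₀ (Ω ×ˢ Set.univ)) :
    Integrable (actionMarginal m f₀) (volume.restrict Ω) :=
  (integrable_density hc hpos hf).integral_prod_left

theorem isFiniteMeasure_equilibrium (hc : Continuous m) (hpos : ∀ θ, 0 < m θ)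
    (hf : IntegrableOn f₀ (Ω ×ˢ Set.univ)) : IsFiniteMeasure (equilibrium Ω m f₀) := by
  have h1 := isFiniteMeasure_withDensity_ofReal (integrable_actionMarginal hc hpos hf).2
  have h2 := isFiniteMeasure_withDensity_ofReal
    ((integrable_torus ⟨rho m, continuous_rho hc hpos⟩).div_const (∫ ϑ : Torus N, rho m ϑ)).2
  rw [equilibrium]
  infer_instance

/-- This is the form in which mixing delivers its limit: the ρ-mean of the observable depends on the
action alone, so integrating the density over the angle leaves the factor W(I). -/
theorem integral_equilibrium (hc : Continuous m) (hpos : ∀ θ, 0 < m θ)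
    (hf : IntegrableOn f₀ (Ω ×ˢ Set.univ))
    (hf0 : ∀ᵐ z ∂((volume : Measure (Euc N × Torus N)).restrict (Ω ×ˢ Set.univ)), 0 ≤ f₀ z)
    (G : BoundedContinuousFunction (Euc N × Torus N) ℝ) :
    ∫ z, G z ∂(equilibrium Ω m f₀)
      = ∫ z, (f₀ z * rho m z.2) * rhoMean hc hpos (G.toContinuousMap.curry z.1)
          ∂((volume.restrict Ω).prod volume) := by
  have hd := integrable_density hc hpos hf
  have := isFiniteMeasure_equilibrium hc hpos hf
  have hGi : Integrable G (equilibrium Ω m f₀) := G.integrable _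
  have hcurry : ∀ I, ‖G.toContinuousMap.curry I‖ ≤ ‖G‖ := fun I =>
    (ContinuousMap.norm_le _ (norm_nonneg _)).2 fun θ => G.norm_coe_le_norm (I, θ)
  have hi2 : Integrable (fun z => (f₀ z * rho m z.2) *
      rhoMean hc hpos (G.toContinuousMap.curry z.1)) ((volume.restrict Ω).prod volume) := by
    refine hd.mul_bdd (c := ‖G‖) (Continuous.aestronglyMeasurable ?_)
      (Eventually.of_forall fun z => (norm_rhoMean_le hc hpos _).trans (hcurry _))
    exact (rhoMean hc hpos).continuous.comp
      (G.toContinuousMap.curry.continuous.comp continuous_fst)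
  have hr := integral_rho_pos hc hpos
  have hW0 : ∀ᵐ I ∂(volume.restrict Ω), 0 ≤ actionMarginal m f₀ I := by
    rw [volume_restrict_prod_univ] at hf0
    filter_upwards [Measure.ae_ae_of_ae_prod hf0] with I hI
    refine integral_nonneg_of_ae ?_
    filter_upwards [hI] with θ hθ
    exact mul_nonneg hθ (rho_pos hpos _).le
  rw [integral_prod _ hi2]
  simp only [integral_mul_const]
  rw [equilibrium] at hGi ⊢
  rw [integral_prod _ hGi, integral_withDensity_eq_integral_toReal_smul₀
    (integrable_actionMarginal hc hpos hf).aestronglyMeasurable.aemeasurable.ennreal_ofReal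
    (Eventually.of_forall fun _ => ENNReal.ofReal_lt_top)]
  refine integral_congr_ae ?_
  filter_upwards [hW0] with I hI
  rw [ENNReal.toReal_ofReal hI, smul_eq_mul, integral_withDensity_eq_integral_toReal_smul
    ((continuous_rho hc hpos).div_const _).measurable.ennreal_ofReal
    (Eventually.of_forall fun _ => ENNReal.ofReal_lt_top), actionMarginal, rhoMean_apply,
    ← integral_div]
  congr 2
  ext θ
  rw [ENNReal.toReal_ofReal (div_nonneg (rho_pos hpos _).le hr.le), smul_eq_mul,
    div_mul_eq_mul_div, mul_comm (rho m θ)]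
  rfl

end

/-! ### Convergence to equilibrium -/

theorem mainTheorem3 (N : ℕ) (hN : 0 < N)
    (Ω : Set (Euc N)) (hΩ : IsBoundedLipschitzDomain Ω)
    -- the weight `m` and the Hamiltonian `H`
    (m : Torus N → ℝ) (hm_pos : ∀ θ, 0 < m θ)
    (q : ℕ) (hq : 2 * N < q) (hm : TorusContDiff q m)
    (H : Euc N → ℝ) (hH : ContDiffOn ℝ 2 H Ω)
    -- (D1) nonresonance
    (τ : ℝ) (hτ : 2 * ((N : ℝ) - 1) < 2 * τ) (hτq : 2 * τ ≤ (q : ℝ) - N - 1)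
    (hD1 : ∀ᵐ I ∂(volume.restrict Ω), ∃ α > 0, ∀ n : Fin N → ℤ, n ≠ 0 →
      α * ‖intVec n‖ ^ (-τ) ≤ |inner ℝ (intVec n) (gradient H I)|)
    -- (D2) nondegeneracy: the smallest singular value of `Dω` is at least `lam`
    (lam : ℝ) (hlam : 0 < lam)
    (hD2 : ∀ I ∈ Ω, lam ≤ (fderiv ℝ (gradient H) I).toLinearMap.singularValues (N - 1))
    (hω2 : DifferentiableOn ℝ (fderiv ℝ (gradient H)) Ω)
    (B : ℝ) (hB1 : ∀ I ∈ Ω, ‖fderiv ℝ (gradient H) I‖ ≤ B)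
    (hB2 : ∀ I ∈ Ω, ‖fderiv ℝ (fderiv ℝ (gradient H)) I‖ ≤ B)
    -- the initial density
    (f₀ : Euc N × Torus N → ℝ) (hf₀ : MemW11Action Ω f₀)
    (hf₀_nonneg : ∀ᵐ z ∂(volume.restrict (Ω ×ˢ Set.univ)), 0 ≤ f₀ z)
    (hW : MemW11 Ω (actionMarginal m f₀))
    -- the observable
    (r : ℕ) (hr : N + 1 < r)
    (G : Euc N × Torus N → ℝ) (hG : MemCrClosure r Ω G) :
    (∀ t, Integrable G (ensemble Ω m H f₀ t)) ∧
    Integrable G (equilibrium Ω m f₀) ∧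
    Tendsto (fun t : ℝ => ∫ z, G z ∂(ensemble Ω m H f₀ t)) atTop
      (𝓝 (∫ z, G z ∂(equilibrium Ω m f₀))) := by
  have hc := continuous_of_torusContDiff hm
  have hΩm := hΩ.isOpen.measurableSet
  have hf := hf₀.1
  -- All the measures involved are carried by Ω × 𝕋^N, so G may be replaced by a globally bounded
  -- continuous extension.
  obtain ⟨G', hG'⟩ := exists_boundedContinuous_extension hΩ.isBounded hG.1
  have hsub : ∀ z ∈ Ω ×ˢ (Set.univ : Set (Torus N)), G' z = G z := fun z hz =>
    hG' z ⟨subset_closure hz.1, trivial⟩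
  have hens : ∀ t, G' =ᵐ[ensemble Ω m H f₀ t] G := fun t =>
    (ae_ensemble_mem hΩm hc hm_pos t).mono hsub
  have heq : G' =ᵐ[equilibrium Ω m f₀] G := (ae_equilibrium_mem hΩm).mono hsub
  refine ⟨fun t => ?_, ?_, ?_⟩
  · have := isFiniteMeasure_ensemble (H := H) hc hm_pos hf t
    exact (G'.integrable _).congr (hens t)
  · have := isFiniteMeasure_equilibrium hc hm_pos hf
    exact (G'.integrable _).congr heq
  · rw [← integral_congr_ae heq, integral_equilibrium hc hm_pos hf hf₀_nonneg]
    refine (tendsto_integral_mul_phaseFlow hc hm_pos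
      (absolutelyContinuous_map_gradient hN hΩ.isOpen hH hlam hD2)
      (integrable_density hc hm_pos hf) G').congr fun t => ?_
    rw [← integral_congr_ae (hens t), integral_ensemble hc hm_pos hf hf₀_nonneg t G'.continuous]
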